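/- **Setting.** Let $\mathcal A$ be a finite alphabet with $d$ elements. *Admissible combinatorial data* on $\mathcal A$ are pairs $(\pi_0,\pi_1)$ of bijections $\mathcal A\to\{1,\dots,d\}$ with $\pi_0^{-1}(\{1,\dots,k\})\neq\pi_1^{-1}(\{1,\dots,k\})$ for $1\le k<d$. For $\varepsilon\in\{0,1\}$ let $\alpha_\varepsilon$ be the name with $\pi_\varepsilon(\alpha_\varepsilon)=d$, and let $R_\varepsilon(\pi_0,\pi_1)=(\hat\pi_0,\hat\pi_1)$ be given by $\hat\pi_\varepsilon=\pi_\varepsilon$ and, with $a=\pi_{1-\varepsilon}(\alpha_\varepsilon)$, $\hat\pi_{1-\varepsilon}(\alpha)=\pi_{1-\varepsilon}(\alpha)$ if $\pi_{1-\varepsilon}(\alpha)\le a$, $\hat\pi_{1-\varepsilon}(\alpha)=\pi_{1-\varepsilon}(\alpha)+1$ if $a<\pi_{1-\varepsilon}(\alpha)<d$, and $\hat\pi_{1-\varepsilon}(\alpha)=a+1$ if $\pi_{1-\varepsilon}(\alpha)=d>a$. The Rauzy graph has the admissible pairs as vertices and, from each vertex $(\pi_0,\pi_1)$, one arrow of each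 type $\varepsilon\in\{0,1\}$, which leads to $R_\varepsilon(\pi_0,\pi_1)$ and has the *name* $\alpha_\varepsilon$. The Rauzy diagrams are the connected components of this graph. An interval exchange map (i.e.m.) $T$ is given by an admissible pair $(\pi_0,\pi_1)$ and lengths $\lambda_\alpha>0$ ($\alpha\in\mathcal A$). If $\lambda_{\alpha_\varepsilon}>\lambda_{\alpha_{1-\varepsilon}}$, the basic operation of the Rauzy–Veech algorithm replaces $(\pi_0,\pi_1)$ by $R_\varepsilon(\pi_0,\pi_1)$ and $\lambda_{\alpha_\varepsilon}$ by $\lambda_{\alpha_\varepsilon}-\lambda_{\alpha_{1-\varepsilon}}$, keeps the other lengths, and follows the arrow of type $\varepsilon$; it is undefined if $\lambda_{\alpha_0}=\lambda_{\alpha_1}$. Let $\gamma^{(n)}(T)$, $n>0$, be the arrow followed at the $n$-th iteration, if the first $n$ iterations are defined. For $D\ge1$, a segment $(\gamma^{(n)}(T))_{p\le n<q}$ is a *$D$-segment* if its arrows take at most $D$ distinct names. For a finite path $\gamma=(\gamma^{(n)})_{0<n\le N}$ in a Rauzy diagram starting at $(\pi_0,\pi_1)$, let $\Delta(\gamma)$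 be the simplex of all i.e.m.s $T$ with combinatorial data $(\pi_0,\pi_1)$ and $\sum_\alpha\lambda_\alpha=1$ such that $\gamma^{(n)}(T)=\gamma^{(n)}$ for $0<n\le N$ (i.e.m.s with fixed combinatorial data are identified with their length vectors in $\mathbb R^{\mathcal A}$); $\mathrm{vol}_{d-1}$ is the $(d-1)$-dimensional Euclidean volume. **Proposition.** For every $d$ there exist an integer $l=l(d)$ and a constant $\eta=\eta(d)>0$ with the following properties. Let $\mathcal A$ be an alphabet with $d$ elements, let $(\pi_0,\pi_1)$ be admissible combinatorial data on $\mathcal A$, and let $\gamma=(\gamma^{(n)})_{0<n\le N}$ be a finite path starting at $(\pi_0,\pi_1)$ in its Rauzy diagram, such that the set $\mathcal A'$ of names of arrows of $\gamma$ is distinct from $\mathcal A$. Assume that $D=\operatorname{card}\mathcal A'>1$. Then there is a measurable subset $\Delta'(\gamma)$ of $\Delta(\gamma)$ with $$\mathrm{vol}_{d-1}(\Delta'(\gamma))\ge\eta\,\mathrm{vol}_{d-1}(\Delta(\gamma))$$ such that, for every $T\in\Delta'(\gamma)$, there exists $M>N$ for which $\gamma^{(M)}(T)$ is defined and - the name of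 $\gamma^{(M)}(T)$ does not belong to $\mathcal A'$; - no more than $l$ $(D-1)$-segments are needed to cover $(\gamma^{(n)}(T))_{N\le n<M}$. -/

import Mathlib

open MeasureTheory

noncomputable section

/-- The last position, that is, position `d` of `{1, …, d}`; positions are numbered from `0` here,
so it is `d - 1`. -/
def lastPos (A : Type*) [Fintype A] [Nonempty A] : Fin (Fintype.card A) :=
  ⟨Fintype.card A - 1, Nat.sub_lt Fintype.card_pos Nat.one_pos⟩

/-- The map on positions by which a Rauzy operation moves the last position just after `a`:
`v ↦ v` if `v ≤ a`, `v ↦ a + 1` if `v` is the last position, and `v ↦ v + 1` otherwise. -/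
def shiftFun {n : ℕ} (a v : Fin n) : Fin n :=
  if h : v.val ≤ a.val then v
  else if h' : v.val + 1 = n then ⟨a.val + 1, by omega⟩
  else ⟨v.val + 1, by omega⟩

theorem shiftFun_val {n : ℕ} (a v : Fin n) :
    (shiftFun a v).val =
      if v.val ≤ a.val then v.val else if v.val + 1 = n then a.val + 1 else v.val + 1 := by
  unfold shiftFun
  split_ifs <;> rfl

theorem shiftFun_bijective {n : ℕ} (a : Fin n) : Function.Bijective (shiftFun a) := by
  refine Finite.injective_iff_bijective.mp fun v w h => ?_
  have h' := congrArg Fin.val h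
  rw [shiftFun_val, shiftFun_val] at h'
  ext
  split_ifs at h' <;> omega

/-- `shiftFun a` as a permutation of the positions. -/
def shiftPerm {n : ℕ} (a : Fin n) : Equiv.Perm (Fin n) :=
  Equiv.ofBijective (shiftFun a) (shiftFun_bijective a)

/-- Admissibility of a pair of bijections `(π 0, π 1)`: the sets of the `k` first names differ,
for `1 ≤ k < d`. -/
def IsAdmissible {A : Type*} [Fintype A] (π : Fin 2 → (A ≃ Fin (Fintype.card A))) : Prop :=
  ∀ k : ℕ, 1 ≤ k → k < Fintype.card A → {α | (π 0 α).val < k} ≠ {α | (π 1 α).val < k}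

/-- Admissible combinatorial data on the alphabet `A`, that is, a vertex of the Rauzy graph. -/
structure RauzyVertex (A : Type*) [Fintype A] where
  /-- The two bijections from `A` to the positions. -/
  π : Fin 2 → (A ≃ Fin (Fintype.card A))
  admissible : IsAdmissible π

/-- The name `α_ε` with `π_ε (α_ε) = d`. -/
def RauzyVertex.lastName {A : Type*} [Fintype A] [Nonempty A] (v : RauzyVertex A) (ε : Fin 2) : A :=
  (v.π ε).symm (lastPos A)

/-- The pair `R_ε (π_0, π_1)`: the bijection `π_ε` is kept and, in the order given by the other one,
the last name is moved just after `α_ε`. -/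
def rauzyPair {A : Type*} [Fintype A] [Nonempty A] (v : RauzyVertex A) (ε : Fin 2) :
    Fin 2 → (A ≃ Fin (Fintype.card A)) := fun δ =>
  if δ = ε then v.π δ else (v.π δ).trans (shiftPerm (v.π δ (v.lastName ε)))

theorem rauzyPair_admissible {A : Type*} [Fintype A] [Nonempty A] (v : RauzyVertex A)
    (ε : Fin 2) : IsAdmissible (rauzyPair v ε) := by
  have key : ∀ δ : Fin 2, δ ≠ ε → ∀ k : ℕ, 1 ≤ k → k < Fintype.card A →
      {α | (v.π ε α).val < k} ≠ {α | (v.π δ α).val < k} →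
      {α | (v.π ε α).val < k} ≠
        {α | (shiftPerm (v.π δ (v.lastName ε)) (v.π δ α)).val < k} := by
    intro δ _ k _ hk hne heq
    by_cases hka : k ≤ (v.π δ (v.lastName ε)).val
    · refine hne (heq.trans ?_)
      ext α
      simp only [Set.mem_ofPred_eq, shiftPerm, Equiv.ofBijective_apply, shiftFun_val]
      split_ifs <;> omega
    · have hm : v.lastName ε ∈ {α | (v.π ε α).val < k} := by
        rw [heq]
        simp only [Set.mem_ofPred_eq, shiftPerm, Equiv.ofBijective_apply, shiftFun_val, le_refl,
          if_true]
        omega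
      simp only [Set.mem_ofPred_eq, RauzyVertex.lastName, Equiv.apply_symm_apply, lastPos] at hm
      omega
  intro k hk1 hk
  have hv := v.admissible k hk1 hk
  by_cases hε : ε = 0
  · subst hε
    simpa [rauzyPair] using key 1 (by decide) k hk1 hk hv
  · obtain rfl : ε = 1 := by omega
    simpa [rauzyPair] using (key 0 (by decide) k hk1 hk hv.symm).symm

/-- The Rauzy operation `R_ε` on admissible pairs. -/
def RauzyVertex.op {A : Type*} [Fintype A] [Nonempty A] (v : RauzyVertex A) (ε : Fin 2) :
    RauzyVertex A := ⟨rauzyPair v ε, rauzyPair_admissible v ε⟩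

/-- An arrow of the Rauzy graph: from each vertex there starts exactly one arrow of each type. -/
structure RauzyArrow (A : Type*) [Fintype A] where
  source : RauzyVertex A
  type : Fin 2

/-- The endpoint of an arrow. -/
def RauzyArrow.target {A : Type*} [Fintype A] [Nonempty A] (a : RauzyArrow A) : RauzyVertex A :=
  a.source.op a.type

/-- The name of an arrow. -/
def RauzyArrow.name {A : Type*} [Fintype A] [Nonempty A] (a : RauzyArrow A) : A :=
  a.source.lastName a.type

/-- A finite path `(γ^{(n)})_{0 < n ≤ N}` starting at `v` (hence contained in the Rauzy diagram,
i.e. the connected component, of `v`); `arrow i` is `γ^{(i+1)}`. -/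
structure RauzyPath {A : Type*} [Fintype A] [Nonempty A] (v : RauzyVertex A) (N : ℕ) where
  arrow : Fin N → RauzyArrow A
  start : ∀ h : 0 < N, (arrow ⟨0, h⟩).source = v
  chain : ∀ (i : ℕ) (h : i + 1 < N),
    (arrow ⟨i + 1, h⟩).source = (arrow ⟨i, Nat.lt_of_succ_lt h⟩).target

/-- The set of names taken by the arrows of a finite path. -/
def RauzyPath.names {A : Type*} [Fintype A] [Nonempty A] {v : RauzyVertex A} {N : ℕ}
    (γ : RauzyPath v N) : Set A :=
  Set.range fun i => (γ.arrow i).name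

/-- An interval exchange map, given by admissible combinatorial data and positive lengths. -/
structure IEM (A : Type*) [Fintype A] where
  vertex : RauzyVertex A
  len : A → ℝ
  len_pos : ∀ α, 0 < len α

/-- Among the two last intervals, the one named `α_ε` is strictly the longer one. -/
def IEM.Wins {A : Type*} [Fintype A] [Nonempty A] (T : IEM A) (ε : Fin 2) : Prop :=
  T.len (T.vertex.lastName (1 - ε)) < T.len (T.vertex.lastName ε)

open Classical in
/-- The basic operation, when `α_ε` is the longer one: the data become `R_ε (π_0, π_1)`, the length
of `α_{1-ε}` is subtracted from that of `α_ε`, and the other lengths are kept. -/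
def IEM.step {A : Type*} [Fintype A] [Nonempty A] (T : IEM A) (ε : Fin 2) (h : T.Wins ε) :
    IEM A where
  vertex := T.vertex.op ε
  len α := if α = T.vertex.lastName ε then
      T.len (T.vertex.lastName ε) - T.len (T.vertex.lastName (1 - ε))
    else T.len α
  len_pos α := by
    split_ifs
    · exact sub_pos.mpr h
    · exact T.len_pos α

open Classical in
/-- The basic operation; it is undefined when the two last intervals have the same length. -/
def IEM.next {A : Type*} [Fintype A] [Nonempty A] (T : IEM A) : Option (IEM A) :=
  if h : T.Wins 0 then some (T.step 0 h) else if h : T.Wins 1 then some (T.step 1 h) else none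

open Classical in
/-- The arrow of the Rauzy diagram followed by the basic operation, if the latter is defined. -/
def IEM.firstArrow {A : Type*} [Fintype A] [Nonempty A] (T : IEM A) : Option (RauzyArrow A) :=
  if T.Wins 0 then some ⟨T.vertex, 0⟩ else if T.Wins 1 then some ⟨T.vertex, 1⟩ else none

/-- The i.e.m. `T^{(n)}` obtained after `n` basic operations, if they can all be performed. -/
def IEM.iter {A : Type*} [Fintype A] [Nonempty A] (T : IEM A) : ℕ → Option (IEM A)
  | 0 => some T
  | n + 1 => (T.iter n).bind IEM.next

/-- The arrow `γ^{(n)}(T)`, for `n > 0`, from the data of `T^{(n-1)}` to those of `T^{(n)}`, if the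
first `n` basic operations can be performed. -/
def IEM.arrow {A : Type*} [Fintype A] [Nonempty A] (T : IEM A) : ℕ → Option (RauzyArrow A)
  | 0 => none
  | n + 1 => (T.iter n).bind IEM.firstArrow

/-- `(γ^{(n)}(T))_{p ≤ n < q}` is a `D`-segment: its arrows exist and take at most `D` distinct
names. -/
def IEM.IsSegment {A : Type*} [Fintype A] [Nonempty A] (T : IEM A) (D p q : ℕ) : Prop :=
  (∀ n, p ≤ n → n < q → (T.arrow n).isSome) ∧
    {α : A | ∃ n, p ≤ n ∧ n < q ∧ ∃ a ∈ T.arrow n, a.name = α}.ncard ≤ D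

/-- `(γ^{(n)}(T))_{p ≤ n < q}` is covered by (at most) `l` `D`-segments; they may overlap or be
empty. -/
def IEM.CoveredBySegments {A : Type*} [Fintype A] [Nonempty A] (T : IEM A) (l D p q : ℕ) : Prop :=
  ∃ s t : Fin l → ℕ, (∀ i, T.IsSegment D (s i) (t i)) ∧
    ∀ n, p ≤ n → n < q → ∃ i, s i ≤ n ∧ n < t i

/-- The simplex `Δ(γ)`: the length vectors of total length `1` for which the i.e.m. `T` with these
lengths and the data at the start of `γ` satisfies `γ^{(n)}(T) = γ^{(n)}` for `0 < n ≤ N`. -/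
def RauzyPath.simplex {A : Type*} [Fintype A] [Nonempty A] {v : RauzyVertex A} {N : ℕ}
    (γ : RauzyPath v N) : Set (EuclideanSpace ℝ A) :=
  {x | ∃ T : IEM A, T.vertex = v ∧ (∀ α, T.len α = x α) ∧ ∑ α, T.len α = 1 ∧
    ∀ i : Fin N, T.arrow (i.val + 1) = some (γ.arrow i)}

/-- The `(d-1)`-dimensional volume on `ℝ^A`, where `d` is the cardinality of `A`: the Hausdorff
measure of dimension `d - 1` for the Euclidean distance. -/
def simplexVolume (A : Type*) [Fintype A] : Measure (EuclideanSpace ℝ A) :=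
  Measure.hausdorffMeasure ((Fintype.card A : ℝ) - 1)

end

set_option linter.unusedSectionVars false

/-! Give every name the weight 1 and let each arrow add the weight of its winner to that of its
loser. The weights are then the column sums of the length matrix, which has determinant 1, so the
volume of the simplex of a path is the product of the inverse weights, up to a common factor.
Following an arrow thus has a conditional probability that depends on the weights of the two last
names only, namely the loser's weight divided by the sum of both. The theorem becomes a lower bound,
uniform in the weights, for a random walk on the Rauzy diagram. `Reach` is a finite certificate for
such bounds, and `Reach.exists_subset` turns it into a measurable set of lengths.

Suppose that all weights are at most `M` and that those of a nonempty `G ⊆ S` are at least `c * M`.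
A short path with winners and losers in `G` brings a name outside `G` to an end of a row
(`RauzyVertex.exists_staysIn`), and it has probability bounded below because its losers are heavy.
From there, either the walk can leave `S` at once, or it enters an excursion with winners in `S \
G`, a smaller set that is left with definite probability by induction. The excursion ends outside
`S`, or with a winner in `G` whose weight is added to that of a name of `S \ G`, so that `G` can be
enlarged. At most `card S` rounds are needed, each made of boundedly many arrows and an excursion
that misses a name of `S`: this yields the covering by segments with one name fewer
(`LargeExitBound.succ`).

The induction also needs exits without any heavy name in `S`. By a supermartingale argument in the
style of Kerckhoff, with probability at least 1/2 the walk leaves `S` or makes a name of `S` heavy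
before the other weights grow much (`reach_exits_or_large`, `exitBound`). This preliminary stage may
use all the names of `S`, so it is not allowed at the end of `γ`. There it is replaced by a
deterministic fact: as `γ` uses at least two names, every weight is at most the total weight of its
names (`WeightedVertex.wt_run_le_sum`), so one of these names is heavy already. -/

theorem one_sub_ne_self (ε : Fin 2) : 1 - ε ≠ ε := by revert ε; decide

theorem one_sub_one_sub_self (ε : Fin 2) : 1 - (1 - ε) = ε := by revert ε; decide

theorem eq_or_eq_one_sub (ε δ : Fin 2) : δ = ε ∨ δ = 1 - ε := by revert ε δ; decide

noncomputable section

open scoped Classical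

/-! ### Words of arrow types, and positions of names in the two rows -/

namespace RauzyVertex

variable {A : Type*} [Fintype A] [Nonempty A]

/-- The vertex reached from `v` by following the arrows whose types are listed in a word. -/
def run : RauzyVertex A → List (Fin 2) → RauzyVertex A
  | v, [] => v
  | v, ε :: w => (v.op ε).run w

/-- The names of the arrows followed from `v`, for a given word of types. -/
def names : RauzyVertex A → List (Fin 2) → List A
  | _, [] => []
  | v, ε :: w => v.lastName ε :: (v.op ε).names w

@[simp] theorem run_nil (v : RauzyVertex A) : v.run [] = v := rfl

@[simp] theorem run_cons (v : RauzyVertex A) (ε : Fin 2) (w : List (Fin 2)) :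
    v.run (ε :: w) = (v.op ε).run w := rfl

@[simp] theorem names_nil (v : RauzyVertex A) : v.names [] = [] := rfl

@[simp] theorem names_cons (v : RauzyVertex A) (ε : Fin 2) (w : List (Fin 2)) :
    v.names (ε :: w) = v.lastName ε :: (v.op ε).names w := rfl

theorem run_append (v : RauzyVertex A) (u w : List (Fin 2)) :
    v.run (u ++ w) = (v.run u).run w := by
  induction u generalizing v with
  | nil => rfl
  | cons ε u ih => exact ih _

theorem names_append (v : RauzyVertex A) (u w : List (Fin 2)) :
    v.names (u ++ w) = v.names u ++ (v.run u).names w := by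
  induction u generalizing v with
  | nil => rfl
  | cons ε u ih => simp [ih]

@[simp] theorem length_names (v : RauzyVertex A) (w : List (Fin 2)) :
    (v.names w).length = w.length := by
  induction w generalizing v with
  | nil => rfl
  | cons ε u ih => simp [ih]

/-- The position of a name in one of the two rows. -/
def pos (v : RauzyVertex A) (δ : Fin 2) (x : A) : ℕ := (v.π δ x).val

theorem pos_lt (v : RauzyVertex A) (δ : Fin 2) (x : A) : v.pos δ x < Fintype.card A :=
  (v.π δ x).isLt

theorem pos_injective (v : RauzyVertex A) (δ : Fin 2) : Function.Injective (v.pos δ) :=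
  fun _ _ h => (v.π δ).injective (Fin.ext h)

theorem pos_lastName (v : RauzyVertex A) (δ : Fin 2) :
    v.pos δ (v.lastName δ) = Fintype.card A - 1 := by
  simp [pos, lastName, lastPos]

theorem pos_succ_eq_iff (v : RauzyVertex A) (δ : Fin 2) (x : A) :
    v.pos δ x + 1 = Fintype.card A ↔ x = v.lastName δ := by
  have h := v.pos_lt δ x
  constructor
  · intro hx
    refine v.pos_injective δ ?_
    rw [pos_lastName]; omega
  · rintro rfl
    rw [pos_lastName]; omega

theorem pos_op_self (v : RauzyVertex A) (ε : Fin 2) (x : A) :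
    (v.op ε).pos ε x = v.pos ε x := by
  simp [pos, op, rauzyPair]

theorem pos_op_other (v : RauzyVertex A) (ε : Fin 2) (x : A) :
    (v.op ε).pos (1 - ε) x =
      if v.pos (1 - ε) x ≤ v.pos (1 - ε) (v.lastName ε) then v.pos (1 - ε) x
      else if x = v.lastName (1 - ε) then v.pos (1 - ε) (v.lastName ε) + 1
      else v.pos (1 - ε) x + 1 := by
  have h : (v.op ε).pos (1 - ε) x =
      (shiftFun (v.π (1 - ε) (v.lastName ε)) (v.π (1 - ε) x)).val := by
    simp only [pos, op, rauzyPair, one_sub_ne_self, if_false, Equiv.trans_apply, shiftPerm,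
      Equiv.ofBijective_apply]
  have h' := v.pos_succ_eq_iff (1 - ε) x
  rw [h, shiftFun_val]
  change (if v.pos (1 - ε) x ≤ v.pos (1 - ε) (v.lastName ε) then v.pos (1 - ε) x
    else if v.pos (1 - ε) x + 1 = _ then v.pos (1 - ε) (v.lastName ε) + 1
    else v.pos (1 - ε) x + 1) = _
  by_cases h1 : v.pos (1 - ε) x ≤ v.pos (1 - ε) (v.lastName ε)
  · simp only [if_pos h1]
  · simp only [if_neg h1]
    by_cases h2 : x = v.lastName (1 - ε)
    · simp only [if_pos (h'.2 h2), if_pos h2]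
    · simp only [if_neg (mt h'.1 h2), if_neg h2]

@[simp] theorem lastName_op_self (v : RauzyVertex A) (ε : Fin 2) :
    (v.op ε).lastName ε = v.lastName ε := by
  rw [eq_comm, ← pos_succ_eq_iff, pos_op_self, pos_succ_eq_iff]

theorem lastName_ne (hA : 1 < Fintype.card A) (v : RauzyVertex A) (ε : Fin 2) :
    v.lastName ε ≠ v.lastName (1 - ε) := by
  have key : v.lastName 0 ≠ v.lastName 1 := by
    intro h
    refine v.admissible (Fintype.card A - 1) (by omega) (by omega) ?_
    have (δ : Fin 2) : {α | (v.π δ α).val < Fintype.card A - 1} = {α | α ≠ v.lastName δ} := by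
      ext α
      have h1 := v.pos_succ_eq_iff δ α
      have h2 := v.pos_lt δ α
      simp only [Set.mem_ofPred_eq, ne_eq, ← h1]
      change v.pos δ α < _ ↔ _
      omega
    rw [this, this, h]
  obtain rfl | rfl : ε = 0 ∨ ε = 1 := by omega
  · exact key
  · exact key.symm

end RauzyVertex

/-! ### Weights and transition probabilities -/

/-- A vertex of the Rauzy graph with positive weights on the names. -/
structure WeightedVertex (A : Type*) [Fintype A] where
  vertex : RauzyVertex A
  wt : A → ℝ
  wt_pos : ∀ α, 0 < wt α

namespace WeightedVertex

variable {A : Type*} [Fintype A] [Nonempty A]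

/-- The arrow of type `ε` adds the weight of the winner to the weight of the loser. -/
def next (s : WeightedVertex A) (ε : Fin 2) : WeightedVertex A where
  vertex := s.vertex.op ε
  wt α := if α = s.vertex.lastName (1 - ε) then
      s.wt (s.vertex.lastName (1 - ε)) + s.wt (s.vertex.lastName ε) else s.wt α
  wt_pos α := by
    split_ifs
    · exact add_pos (s.wt_pos _) (s.wt_pos _)
    · exact s.wt_pos α

/-- The weighted vertex reached by following a word. -/
def run : WeightedVertex A → List (Fin 2) → WeightedVertex A
  | s, [] => s
  | s, ε :: w => (s.next ε).run w

/-- The proportion of the simplex in which the arrow of type `ε` is followed. -/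
def prob (s : WeightedVertex A) (ε : Fin 2) : ℝ :=
  s.wt (s.vertex.lastName (1 - ε)) /
    (s.wt (s.vertex.lastName ε) + s.wt (s.vertex.lastName (1 - ε)))

@[simp] theorem run_nil (s : WeightedVertex A) : s.run [] = s := rfl

@[simp] theorem run_cons (s : WeightedVertex A) (ε : Fin 2) (w : List (Fin 2)) :
    s.run (ε :: w) = (s.next ε).run w := rfl

theorem run_append (s : WeightedVertex A) (u w : List (Fin 2)) :
    s.run (u ++ w) = (s.run u).run w := by
  induction u generalizing s with
  | nil => rfl
  | cons ε u ih => exact ih _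

@[simp] theorem next_vertex (s : WeightedVertex A) (ε : Fin 2) :
    (s.next ε).vertex = s.vertex.op ε := rfl

@[simp] theorem run_vertex (s : WeightedVertex A) (w : List (Fin 2)) :
    (s.run w).vertex = s.vertex.run w := by
  induction w generalizing s with
  | nil => rfl
  | cons ε u ih => simp [ih]

theorem next_wt (s : WeightedVertex A) (ε : Fin 2) (α : A) :
    (s.next ε).wt α = if α = s.vertex.lastName (1 - ε) then
      s.wt (s.vertex.lastName (1 - ε)) + s.wt (s.vertex.lastName ε) else s.wt α := rfl

theorem next_wt_loser (s : WeightedVertex A) (ε : Fin 2) :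
    (s.next ε).wt (s.vertex.lastName (1 - ε)) =
      s.wt (s.vertex.lastName (1 - ε)) + s.wt (s.vertex.lastName ε) := by
  simp [next_wt]

theorem next_wt_of_ne (s : WeightedVertex A) (ε : Fin 2) {α : A}
    (h : α ≠ s.vertex.lastName (1 - ε)) : (s.next ε).wt α = s.wt α := by
  simp [next_wt, h]

theorem wt_le_next (s : WeightedVertex A) (ε : Fin 2) (α : A) : s.wt α ≤ (s.next ε).wt α := by
  rw [next_wt]
  split_ifs with h
  · rw [h]; linarith [s.wt_pos (s.vertex.lastName ε)]
  · rfl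

theorem wt_le_run (s : WeightedVertex A) (w : List (Fin 2)) (α : A) :
    s.wt α ≤ (s.run w).wt α := by
  induction w generalizing s with
  | nil => rfl
  | cons ε u ih => exact (s.wt_le_next ε α).trans (ih _)

theorem next_wt_le {s : WeightedVertex A} {M : ℝ} (h : ∀ α, s.wt α ≤ M) (ε : Fin 2) (α : A) :
    (s.next ε).wt α ≤ 2 * M := by
  rw [next_wt]
  split_ifs
  · linarith [h (s.vertex.lastName (1 - ε)), h (s.vertex.lastName ε)]
  · linarith [h α, s.wt_pos α]

theorem run_wt_le {s : WeightedVertex A} {M : ℝ} (h : ∀ α, s.wt α ≤ M) (w : List (Fin 2)) (α : A) :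
    (s.run w).wt α ≤ 2 ^ w.length * M := by
  induction w generalizing s M with
  | nil => simpa using h α
  | cons ε u ih =>
    refine (ih (next_wt_le h ε)).trans (le_of_eq ?_)
    rw [List.length_cons, pow_succ]; ring

theorem prob_pos (s : WeightedVertex A) (ε : Fin 2) : 0 < s.prob ε :=
  div_pos (s.wt_pos _) (add_pos (s.wt_pos _) (s.wt_pos _))

theorem prob_add_prob (s : WeightedVertex A) : s.prob 0 + s.prob 1 = 1 := by
  have h0 := s.wt_pos (s.vertex.lastName 0)
  have h1 := s.wt_pos (s.vertex.lastName 1)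
  simp only [prob, sub_zero, sub_self]
  field_simp
  ring

end WeightedVertex

/-! ### Lower bounds for probabilities of words -/

/-- Starting from `s`, and choosing arrows with the probabilities `WeightedVertex.prob`, some word
in `G` is followed with probability at least `p`, within a bounded time. -/
inductive Reach {A : Type*} [Fintype A] [Nonempty A] :
    (List (Fin 2) → Prop) → WeightedVertex A → ℝ → Prop
  | zero {G s p} : p ≤ 0 → Reach G s p
  | attained {G s p} : p ≤ 1 → G [] → Reach G s p
  | node {G s p} (a : Fin 2 → ℝ) : (∀ ε, Reach (fun w => G (ε :: w)) (s.next ε) (a ε)) →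
      p ≤ s.prob 0 * a 0 + s.prob 1 * a 1 → Reach G s p

namespace Reach

variable {A : Type*} [Fintype A] [Nonempty A]

theorem weaken {G : List (Fin 2) → Prop} {s : WeightedVertex A} {p q : ℝ} (h : Reach G s p)
    (hq : q ≤ p) : Reach G s q := by
  cases h with
  | zero h => exact .zero (hq.trans h)
  | attained h hG => exact .attained (hq.trans h) hG
  | node a h hp => exact .node a h (hq.trans hp)

theorem mono {G H : List (Fin 2) → Prop} {s : WeightedVertex A} {p : ℝ} (h : Reach G s p)
    (hGH : ∀ w, G w → H w) : Reach H s p := by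
  induction h generalizing H with
  | zero h => exact .zero h
  | attained h hG => exact .attained h (hGH _ hG)
  | node a h hp ih => exact .node a (fun ε => ih ε fun w hw => hGH _ hw) hp

/-- The Markov property: a second stage is grafted on every success of the first one, and the
probabilities multiply. -/
theorem bind {G H : List (Fin 2) → Prop} {s : WeightedVertex A} {p q : ℝ} (h : Reach G s p)
    (hq : 0 ≤ q) (hGH : ∀ w, G w → Reach (fun u => H (w ++ u)) (s.run w) q) :
    Reach H s (p * q) := by
  induction h generalizing H with
  | zero h => exact .zero (mul_nonpos_of_nonpos_of_nonneg h hq)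
  | attained h hG => exact (hGH _ hG).weaken (mul_le_of_le_one_left hq h)
  | node a h hp ih =>
    refine .node (fun ε => a ε * q) (fun ε => ih ε fun w hw => hGH _ hw) ?_
    nlinarith

theorem step {G : List (Fin 2) → Prop} {s : WeightedVertex A} {p : ℝ} (ε : Fin 2)
    (h : Reach (fun w => G (ε :: w)) (s.next ε) p) : Reach G s (s.prob ε * p) := by
  refine .node (fun δ => if δ = ε then p else 0) (fun δ => ?_) ?_
  · split_ifs with hδ
    · subst hδ; exact h
    · exact .zero le_rfl
  · obtain rfl | rfl : ε = 0 ∨ ε = 1 := by omega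
    · simp
    · simp

theorem branch {G : List (Fin 2) → Prop} {s : WeightedVertex A} {p : ℝ}
    (h : ∀ ε, Reach (fun w => G (ε :: w)) (s.next ε) p) : Reach G s p :=
  .node (fun _ => p) h (by rw [← add_mul, s.prob_add_prob, one_mul])

end Reach


/-! ### Short paths that bring a new name to an end of a row -/

namespace RauzyVertex

variable {A : Type*} [Fintype A] [Nonempty A]

/-- Along the word, both last names always belong to `G`. -/
def StaysIn (G : Finset A) : RauzyVertex A → List (Fin 2) → Prop
  | _, [] => True
  | v, ε :: w => (∀ δ, v.lastName δ ∈ G) ∧ StaysIn G (v.op ε) w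

instance : Finite (RauzyVertex A) :=
  Finite.of_injective (fun v => v.π) fun v w h => by
    cases v; cases w; simpa using h

theorem card_le : Nat.card (RauzyVertex A) ≤ ((Fintype.card A).factorial) ^ 2 := by
  have h : Function.Injective (fun v : RauzyVertex A => v.π) := fun v w h => by
    cases v; cases w; simpa using h
  refine (Nat.card_le_card_of_injective _ h).trans (le_of_eq ?_)
  rw [Nat.card_eq_fintype_card, Fintype.card_fun, Fintype.card_fin,
    Fintype.card_equiv (Fintype.equivFin A)]

/-- The names that are last in some row, at some vertex accessible from `v`. -/
def activeNames (v : RauzyVertex A) : Set A := {x | ∃ w δ, x = (v.run w).lastName δ}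

theorem activeNames_run_subset (v : RauzyVertex A) (w : List (Fin 2)) :
    (v.run w).activeNames ⊆ v.activeNames := by
  rintro x ⟨u, δ, rfl⟩
  exact ⟨w ++ u, δ, by rw [run_append]⟩

theorem pos_le_pos_op {v : RauzyVertex A} {x : A} (hx : ∀ δ, x ≠ v.lastName δ) (ε δ : Fin 2) :
    v.pos δ x ≤ (v.op ε).pos δ x := by
  obtain rfl | rfl := eq_or_eq_one_sub ε δ
  · rw [pos_op_self]
  · rw [pos_op_other, if_neg (hx _)]
    split_ifs <;> omega

theorem pos_le_pos_run {v : RauzyVertex A} {x : A} (hx : x ∉ v.activeNames) (w : List (Fin 2))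
    (δ : Fin 2) : v.pos δ x ≤ (v.run w).pos δ x := by
  induction w generalizing v with
  | nil => rfl
  | cons ε w ih =>
    refine (pos_le_pos_op (fun δ h => hx ⟨[], δ, h⟩) ε δ).trans (ih fun h => hx ?_)
    exact v.activeNames_run_subset [ε] h

/-- Every name is last in some row, at some vertex accessible from `v`. -/
theorem activeNames_eq_univ (hA : 1 < Fintype.card A) (v : RauzyVertex A) :
    v.activeNames = Set.univ := by
  by_contra hne
  -- Names that are never last can only move to the right, and they stay inactive. Hence `Φ` does
  -- not decrease along paths, and beyond a vertex where it is maximal the inactive names are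
  -- frozen.
  let Φ : RauzyVertex A → ℕ := fun v =>
    ∑ x, if x ∈ v.activeNames then 0 else v.pos 0 x + v.pos 1 x + 1
  have hΦ (v : RauzyVertex A) (w : List (Fin 2)) (x : A) : (if x ∈ v.activeNames then 0 else v.pos 0 x + v.pos 1 x + 1) ≤
      if x ∈ (v.run w).activeNames then 0 else (v.run w).pos 0 x + (v.run w).pos 1 x + 1 := by
    by_cases hx : x ∈ v.activeNames
    · simp [hx]
    · have hx' : x ∉ (v.run w).activeNames := fun h => hx (v.activeNames_run_subset w h)
      have h0 := pos_le_pos_run hx w 0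
      have h1 := pos_le_pos_run hx w 1
      simp only [hx, hx', if_false]
      omega
  obtain ⟨w₀, hw₀⟩ : ∃ w₀, ∀ w, Φ (v.run w) ≤ Φ (v.run w₀) := by
    obtain ⟨_, ⟨w₀, rfl⟩, h⟩ := Set.exists_max_image (Set.range v.run) Φ (Set.toFinite _)
      ⟨_, [], rfl⟩
    exact ⟨w₀, fun w => h _ ⟨w, rfl⟩⟩
  set z := v.run w₀ with hz
  have hmax (w) (x) (hx : x ∉ z.activeNames) (δ : Fin 2) : (z.run w).pos δ x = z.pos δ x := by
    have hle := hw₀ (w₀ ++ w)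
    rw [run_append, ← hz] at hle
    have heq := (Finset.sum_eq_sum_iff_of_le fun x _ => hΦ z w x).1
      (le_antisymm (Finset.sum_le_sum fun x _ => hΦ z w x) hle) x (Finset.mem_univ x)
    have hx' : x ∉ (z.run w).activeNames := fun h => hx (z.activeNames_run_subset w h)
    have h0 := pos_le_pos_run hx w 0
    have h1 := pos_le_pos_run hx w 1
    simp only [hx, hx', if_false] at heq
    obtain rfl | rfl : δ = 0 ∨ δ = 1 := by omega
    · omega
    · omega
  -- An inactive name to the right of the winner, in the other row, would be pushed by one position;
  -- being frozen, it lies to the left.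
  have hmove (w) (x) (hx : x ∉ z.activeNames) (ε : Fin 2) :
      (z.run w).pos (1 - ε) x < (z.run w).pos (1 - ε) ((z.run w).lastName ε) := by
    have h1 := hmax (w ++ [ε]) x hx (1 - ε)
    rw [run_append, run_cons, run_nil, pos_op_other, hmax w x hx,
      if_neg (fun h => hx ⟨w, _, h⟩)] at h1
    rw [hmax w x hx]
    have hne : z.pos (1 - ε) x ≠ (z.run w).pos (1 - ε) ((z.run w).lastName ε) := fun h => by
      rw [← hmax w x hx] at h
      exact hx ⟨w, _, (z.run w).pos_injective _ h⟩
    split_ifs at h1 <;> omega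
  have horder (w) (x) (hx : x ∉ z.activeNames) (y) (δ : Fin 2) (hy : z.pos δ y < z.pos δ x) :
      (z.run w).pos δ y < z.pos δ x := by
    induction w using List.reverseRecOn with
    | nil => exact hy
    | append_singleton w ε ih =>
      rw [run_append, run_cons, run_nil]
      obtain rfl | rfl := eq_or_eq_one_sub ε δ
      · rwa [pos_op_self]
      · have := hmove w x hx ε
        rw [hmax w x hx] at this
        rw [pos_op_other, if_pos (by omega)]
        exact ih
  -- An active name to the left of an inactive one in some row would remain there by `horder`. But
  -- at some time it is last: in the same row this is absurd, and in the other row it contradicts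
  -- `hmove`.
  have hlt (x) (hx : x ∉ z.activeNames) (y) (hy : y ∈ z.activeNames) (δ : Fin 2) :
      z.pos δ x < z.pos δ y := by
    by_contra hcon
    have hxy : x ≠ y := fun h => hx (h ▸ hy)
    have hcon' : z.pos δ y < z.pos δ x :=
      lt_of_le_of_ne (not_lt.1 hcon) fun h => hxy (z.pos_injective δ h.symm)
    obtain ⟨w, ε, rfl⟩ := hy
    have h1 := horder w x hx _ δ hcon'
    obtain rfl | rfl := eq_or_eq_one_sub ε δ
    · rw [pos_lastName] at h1
      have := z.pos_lt δ x
      omega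
    · have := hmove w x hx ε
      rw [hmax w x hx] at this
      omega
  set U : Finset A := Finset.univ.filter fun x => x ∉ z.activeNames with hU
  have hmemU (x) : x ∈ U ↔ x ∉ z.activeNames := by simp [hU]
  have hlast : z.lastName 0 ∉ U := by rw [hmemU, not_not]; exact ⟨[], 0, rfl⟩
  have hUne : U.Nonempty := by
    obtain ⟨x, hx⟩ := (Set.ne_univ_iff_exists_notMem _).1 hne
    exact ⟨x, (hmemU x).2 fun h => hx (v.activeNames_run_subset w₀ h)⟩
  -- The inactive names therefore fill the same initial block of both rows, against admissibility.
  have hinit (δ : Fin 2) (x : A) : z.pos δ x < U.card ↔ x ∈ U := by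
    have himg (T : Finset A) : (T.image (z.pos δ)).card = T.card :=
      Finset.card_image_of_injective _ (z.pos_injective δ)
    constructor
    · intro h
      by_contra hx
      have hsub : U.image (z.pos δ) ⊆ Finset.range (z.pos δ x) := by
        intro n hn
        obtain ⟨y, hy, rfl⟩ := Finset.mem_image.1 hn
        exact Finset.mem_range.2 (hlt y ((hmemU y).1 hy) x (by simpa [hmemU] using hx) δ)
      have := Finset.card_le_card hsub
      rw [himg, Finset.card_range] at this
      omega
    · intro hx
      have hsub : Uᶜ.image (z.pos δ) ⊆ Finset.Ioo (z.pos δ x) (Fintype.card A) := by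
        intro n hn
        obtain ⟨y, hy, rfl⟩ := Finset.mem_image.1 hn
        refine Finset.mem_Ioo.2 ⟨hlt x ((hmemU x).1 hx) y ?_ δ, z.pos_lt δ y⟩
        simpa [hmemU] using hy
      have := Finset.card_le_card hsub
      rw [himg, Finset.card_compl, Nat.card_Ioo] at this
      have h1 := z.pos_lt δ x
      have h2 := Finset.card_le_univ U
      omega
  refine z.admissible U.card hUne.card_pos ?_ ?_
  · exact (Finset.card_lt_univ_of_notMem hlast)
  · ext x
    exact (hinit 0 x).trans (hinit 1 x).symm

/-- A shortest path to a vertex with a last name outside `G` works. Its length `f v` is at most the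
number of vertices, since every smaller distance to the target is also attained, at distinct
vertices. -/
theorem exists_staysIn (hA : 1 < Fintype.card A) {G : Finset A} (hG : G ≠ Finset.univ)
    (v : RauzyVertex A) :
    ∃ w : List (Fin 2), w.length ≤ (Fintype.card A).factorial ^ 2 ∧ StaysIn G v w ∧
      ∃ δ, (v.run w).lastName δ ∉ G := by
  obtain ⟨x, hx⟩ : ∃ x, x ∉ G := by
    by_contra! h
    exact hG (Finset.eq_univ_iff_forall.2 h)
  have hex (v : RauzyVertex A) : ∃ n, ∃ w : List (Fin 2), w.length = n ∧
      ∃ δ, (v.run w).lastName δ ∉ G := by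
    obtain ⟨w, δ, h⟩ : x ∈ v.activeNames := by rw [activeNames_eq_univ hA]; trivial
    exact ⟨_, w, rfl, δ, h ▸ hx⟩
  let f : RauzyVertex A → ℕ := fun v => Nat.find (hex v)
  have hf (v) {n} (h : f v = n + 1) : (∀ δ, v.lastName δ ∈ G) ∧ ∃ ε, f (v.op ε) = n := by
    obtain ⟨w, hw, δ, hδ⟩ := Nat.find_spec (hex v)
    refine ⟨fun δ => ?_, ?_⟩
    · by_contra hδ
      have : f v ≤ 0 := Nat.find_min' (hex v) ⟨[], rfl, δ, hδ⟩
      omega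
    · change w.length = f v at hw
      cases w with
      | nil => simp at hw; omega
      | cons ε w =>
        rw [List.length_cons] at hw
        refine ⟨ε, le_antisymm ?_ ?_⟩
        · exact Nat.find_min' (hex (v.op ε)) ⟨w, by omega, δ, hδ⟩
        · obtain ⟨u, hu, δ', hδ'⟩ := Nat.find_spec (hex (v.op ε))
          have : f v ≤ f (v.op ε) + 1 :=
            Nat.find_min' (hex v) ⟨ε :: u, congrArg (· + 1) hu, δ', hδ'⟩
          omega
  have hword (n) : ∀ v, f v = n → ∃ w : List (Fin 2), w.length = n ∧ StaysIn G v w ∧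
      ∃ δ, (v.run w).lastName δ ∉ G := by
    induction n with
    | zero =>
      intro v hv
      obtain ⟨w, hw, h⟩ := Nat.find_spec (hex v)
      change w.length = f v at hw
      rw [hv, List.length_eq_zero_iff] at hw
      subst hw
      exact ⟨[], rfl, trivial, h⟩
    | succ n ih =>
      intro v hv
      obtain ⟨h1, ε, h2⟩ := hf v hv
      obtain ⟨w, hw, h3, h4⟩ := ih _ h2
      exact ⟨ε :: w, by simp [hw], ⟨h1, h3⟩, h4⟩
  have hsurj (n) : ∀ v, n ≤ f v → ∃ z, f z = n := by
    intro v hv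
    induction h : f v - n generalizing v with
    | zero => exact ⟨v, by omega⟩
    | succ k ih =>
      obtain ⟨m, hm⟩ : ∃ m, f v = m + 1 := ⟨f v - 1, by omega⟩
      obtain ⟨ε, hε⟩ := (hf v hm).2
      exact ih (v.op ε) (by omega) (by omega)
  obtain ⟨w, hw, h⟩ := hword _ v rfl
  refine ⟨w, hw.trans_le (le_trans ?_ card_le), h⟩
  have : Nonempty (RauzyVertex A) := ⟨v⟩
  choose! g hg using fun n (h : n ≤ f v) => hsurj n v h
  have hinj : Function.Injective fun n : Fin (f v) => g n := fun m n h => by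
    have h' := congrArg f h
    simp only [hg _ m.2.le, hg _ n.2.le] at h'
    exact Fin.ext h'
  simpa using Nat.card_le_card_of_injective _ hinj

end RauzyVertex

/-! ### Coverings by blocks with few names -/

/-- A list is covered by `l` consecutive blocks, each taking at most `m` distinct values. -/
def CoveredByBlocks {A : Type*} (m : ℕ) : ℕ → List A → Prop
  | 0, x => x = []
  | l + 1, x => ∃ b r, x = b ++ r ∧ b.toFinset.card ≤ m ∧ CoveredByBlocks m l r

namespace CoveredByBlocks

variable {A : Type*} {m : ℕ}

theorem succ {l : ℕ} {x : List A} (h : CoveredByBlocks m l x) : CoveredByBlocks m (l + 1) x :=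
  ⟨[], x, rfl, by simp, h⟩

theorem mono_length {l l' : ℕ} (hl : l ≤ l') {x : List A} (h : CoveredByBlocks m l x) :
    CoveredByBlocks m l' x := by
  induction hl with
  | refl => exact h
  | step _ ih => exact ih.succ

theorem of_card_le {x : List A} (h : x.toFinset.card ≤ m) : CoveredByBlocks m 1 x :=
  ⟨x, [], by simp, h, rfl⟩

theorem append {l l' : ℕ} {x y : List A} (hx : CoveredByBlocks m l x)
    (hy : CoveredByBlocks m l' y) : CoveredByBlocks m (l + l') (x ++ y) := by
  induction l generalizing x with
  | zero => rw [show x = [] from hx, Nat.zero_add]; exact hy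
  | succ l ih =>
    obtain ⟨b, r, rfl, hb, hr⟩ := hx
    rw [Nat.succ_add]
    exact ⟨b, r ++ y, by simp, hb, ih hr⟩

theorem of_length (hm : 1 ≤ m) (x : List A) : CoveredByBlocks m x.length x := by
  induction x with
  | nil => rfl
  | cons a x ih => exact ⟨[a], x, rfl, by simpa using hm, ih⟩

end CoveredByBlocks


universe u

/-! ### Words that leave a set of names -/

section Exits

variable {A : Type*} [Fintype A] [Nonempty A]

/-- The last arrow of the word is the first one whose name is not in `S`, the names of the others
are covered by `l` blocks of at most `m` names, and the final weights are at most `M`. -/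
def Exits (s : WeightedVertex A) (S : Finset A) (m l : ℕ) (M : ℝ) (w : List (Fin 2)) : Prop :=
  ∃ u ε, w = u ++ [ε] ∧ (∀ a ∈ s.vertex.names u, a ∈ S) ∧
    CoveredByBlocks m l (s.vertex.names u) ∧ (s.vertex.run u).lastName ε ∉ S ∧
    ∀ α, (s.run w).wt α ≤ M

theorem Exits.mono {s : WeightedVertex A} {S : Finset A} {m l l' : ℕ} {M M' : ℝ}
    {w : List (Fin 2)} (h : Exits s S m l M w) (hl : l ≤ l') (hM : M ≤ M') :
    Exits s S m l' M' w := by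
  obtain ⟨u, ε, hw, h1, h2, h3, h4⟩ := h
  exact ⟨u, ε, hw, h1, h2.mono_length hl, h3, fun α => (h4 α).trans hM⟩

theorem Exits.append {s : WeightedVertex A} {S : Finset A} {m l l' : ℕ} {M : ℝ}
    {w u : List (Fin 2)} (hw : ∀ a ∈ s.vertex.names w, a ∈ S)
    (hc : CoveredByBlocks m l (s.vertex.names w)) (h : Exits (s.run w) S m l' M u) :
    Exits s S m (l + l') M (w ++ u) := by
  obtain ⟨x, ε, rfl, h1, h2, h3, h4⟩ := h
  rw [WeightedVertex.run_vertex] at h1 h2 h3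
  refine ⟨w ++ x, ε, by simp, ?_, ?_, ?_, ?_⟩
  · rw [RauzyVertex.names_append]
    intro a ha
    exact (List.mem_append.1 ha).elim (hw a) (h1 a)
  · rw [RauzyVertex.names_append]
    exact hc.append h2
  · rwa [RauzyVertex.run_append]
  · rwa [WeightedVertex.run_append]

theorem Exits.single {s : WeightedVertex A} {S : Finset A} {m : ℕ} {M : ℝ} {ε : Fin 2}
    (h : s.vertex.lastName ε ∉ S) (hM : ∀ α, s.wt α ≤ M) : Exits s S m 0 (2 * M) [ε] :=
  ⟨[], ε, rfl, by simp, rfl, h, WeightedVertex.next_wt_le hM ε⟩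

theorem RauzyVertex.names_mem_of_staysIn {G : Finset A} {v : RauzyVertex A} {w : List (Fin 2)}
    (h : StaysIn G v w) : ∀ a ∈ v.names w, a ∈ G := by
  induction w generalizing v with
  | nil => simp
  | cons ε w ih =>
    intro a ha
    rcases List.mem_cons.1 ha with rfl | ha
    · exact h.1 ε
    · exact ih h.2 a ha

/-- The winner of an arrow is still last in its row afterwards. -/
theorem RauzyVertex.exists_lastName_mem {T : Finset A} {v : RauzyVertex A} {w : List (Fin 2)}
    (hw : ∀ a ∈ v.names w, a ∈ T) (hv : ∃ δ, v.lastName δ ∈ T) :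
    ∃ δ, (v.run w).lastName δ ∈ T := by
  induction w generalizing v with
  | nil => exact hv
  | cons ε w ih =>
    refine ih (fun a ha => hw a (List.mem_cons_of_mem _ ha)) ⟨ε, ?_⟩
    rw [lastName_op_self]
    exact hw _ List.mem_cons_self

theorem WeightedVertex.le_prob {s : WeightedVertex A} {ε : Fin 2} {a R : ℝ} (h1 : a ≤ s.wt (s.vertex.lastName (1 - ε))) (h2 : ∀ α, s.wt α ≤ R) :
    a / (2 * R) ≤ s.prob ε := by
  unfold prob
  have h3 := s.wt_pos (s.vertex.lastName ε)
  have h4 := s.wt_pos (s.vertex.lastName (1 - ε))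
  have h5 := h2 (s.vertex.lastName ε)
  have h6 := h2 (s.vertex.lastName (1 - ε))
  gcongr
  linarith

/-- Every loser along the word is in `G`, so each arrow has probability at least `a / (2 * R)`:
weights never decrease, and they at most double at each arrow. -/
theorem reach_word {G : Finset A} {a R : ℝ} (ha : 0 < a) (w : List (Fin 2))
    (s : WeightedVertex A) (hw : s.vertex.StaysIn G w) (hG : ∀ g ∈ G, a ≤ s.wt g)
    (hR : ∀ α, 2 ^ w.length * s.wt α ≤ R) :
    Reach (fun u => u = w) s ((a / (2 * R)) ^ w.length) := by
  induction w generalizing s with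
  | nil => exact .attained (by simp) rfl
  | cons ε w ih =>
    have hR' (α) : s.wt α ≤ R := by
      refine le_trans ?_ (hR α)
      exact le_mul_of_one_le_left (s.wt_pos α).le (one_le_pow₀ one_le_two)
    have hRpos : 0 < R := (s.wt_pos (s.vertex.lastName 0)).trans_le (hR' _)
    have h := ih (s.next ε) hw.2 (fun g hg => (hG g hg).trans (s.wt_le_next ε g)) fun α => by
      have h1 := WeightedVertex.next_wt_le (s := s) (M := R / 2 ^ (w.length + 1))
        (fun α => by rw [le_div_iff₀' (by positivity)]; exact hR α) ε α
      calc _ ≤ 2 ^ w.length * (2 * (R / 2 ^ (w.length + 1))) := by gcongr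
        _ = R := by rw [pow_succ]; field_simp
    refine ((h.mono (H := fun u => ε :: u = ε :: w) fun u hu => by rw [hu]).step
      (G := fun u => u = ε :: w) ε).weaken ?_
    rw [List.length_cons, pow_succ']
    gcongr
    exact WeightedVertex.le_prob (hG _ (hw.1 _)) hR'

end Exits

/-! ### Exit estimates when some names of the set are heavy -/

/-- From any weighted vertex, the names of a set of less than `j` names are left with
probability bounded from below, while the weights are multiplied by a bounded factor. -/
def ExitBound (d j : ℕ) : Prop :=
  ∃ p K : ℝ, 0 < p ∧ 1 ≤ K ∧ ∀ (A : Type u) [Fintype A] [Nonempty A], Fintype.card A = d →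
    ∀ S : Finset A, S.card < j → S ≠ Finset.univ → ∀ (s : WeightedVertex A) (M : ℝ),
      (∀ α, s.wt α ≤ M) → Reach (Exits s S d 1 (K * M)) s p

/-- Like `ExitBound`, for sets `S` of `j` names, with a covering by a bounded number of blocks,
when the weights are large on a subset `G` such that `S \ G` has less than `n` names. -/
def LargeExitBound (d j m n : ℕ) : Prop :=
  ∀ c : ℝ, 0 < c → ∃ (p K : ℝ) (l : ℕ), 0 < p ∧ 1 ≤ K ∧
    ∀ (A : Type u) [Fintype A] [Nonempty A], Fintype.card A = d →
      ∀ S G : Finset A, G ⊆ S → G.Nonempty → S.card = j → (S \ G).card < n → S ≠ Finset.univ →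
        ∀ (s : WeightedVertex A) (M : ℝ), (∀ α, s.wt α ≤ M) → (∀ g ∈ G, c * M ≤ s.wt g) →
          Reach (Exits s S m l (K * M)) s p

/-- One round of the main argument: a short path inside `G`, then an excursion in `S \ G` that ends
outside `S` or adds a name to `G`. Since `G` is nonempty, `S \ G` has at most `j - 1 ≤ m` names, so
the excursion is a single block. -/
theorem LargeExitBound.succ {d j m n : ℕ} (hm : 1 ≤ m) (hj : j ≤ m + 1)
    (hE : ExitBound.{u} d j) (hn : LargeExitBound.{u} d j m n) :
    LargeExitBound.{u} d j m (n + 1) := by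
  intro c hc
  obtain ⟨p₁, K₁, hp₁, hK₁, hE⟩ := hE
  set k := d.factorial ^ 2 with hk
  have hK₁0 : 0 < K₁ := by linarith
  -- The short path has at most `k` arrows and multiplies weights by at most `2 ^ k`, the excursion
  -- by at most `K₁`. Relative to the new bound, the names of `G` keep at least this proportion.
  obtain ⟨p₂, K₂, l₂, hp₂, hK₂, hn⟩ := hn (c / 2 ^ k / K₁) (by positivity)
  set c₁ := c / 2 ^ k with hc₁
  have hc₁0 : 0 < c₁ := by positivity
  refine ⟨(c₁ / 2) ^ k * min (p₁ * min p₂ 1) (min (c₁ / 2) 1), 2 ^ k * (2 * (K₁ * K₂)),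
    k + (2 + l₂), by positivity, ?_, ?_⟩
  · have h1 : (1 : ℝ) ≤ 2 ^ k := one_le_pow₀ one_le_two
    have h2 : 1 ≤ K₁ * K₂ := one_le_mul_of_one_le_of_one_le hK₁ hK₂
    nlinarith
  intro A _ _ hA S G hGS hGne hSj hcard hSu s M hM hG
  obtain ⟨g₀, hg₀⟩ := hGne
  have hM0 : 0 < M := (s.wt_pos g₀).trans_le (hM g₀)
  have hGu : G ≠ Finset.univ := fun h => hSu (Finset.univ_subset_iff.1 (h ▸ hGS))
  have hA1 : 1 < Fintype.card A := by
    have h1 : 0 < G.card := Finset.card_pos.2 ⟨g₀, hg₀⟩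
    have h2 : G.card < Fintype.card A := by
      rw [← Finset.card_univ]
      exact Finset.card_lt_card (Finset.ssubset_univ_iff.2 hGu)
    omega
  obtain ⟨w, hwk, hwG, δ, hδ⟩ := RauzyVertex.exists_staysIn hA1 hGu s.vertex
  rw [hA, ← hk] at hwk
  have hc₁M : c * M = c₁ * (2 ^ k * M) := by rw [hc₁]; field_simp
  have hc₁1 : c₁ ≤ 1 := by
    have h1 := (hG g₀ hg₀).trans (hM g₀)
    have h2 : c ≤ 1 := by
      by_contra! h
      nlinarith
    exact (div_le_self hc.le (one_le_pow₀ one_le_two)).trans h2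
  have hphase : Reach (fun u => u = w) s ((c₁ / 2) ^ k) := by
    refine (reach_word (a := c * M) (R := 2 ^ k * M) (by positivity) w s hwG hG fun α => ?_).weaken
      ?_
    · have : (2 : ℝ) ^ w.length ≤ 2 ^ k := pow_le_pow_right₀ one_le_two hwk
      have := hM α
      have := s.wt_pos α
      gcongr
    · have : c * M / (2 * (2 ^ k * M)) = c₁ / 2 := by rw [hc₁M]; field_simp
      rw [this]
      exact pow_le_pow_of_le_one (by positivity) (by linarith) hwk
  refine hphase.bind (by positivity) fun w' hw' => ?_
  rw [hw']
  set M₁ := 2 ^ k * M with hM₁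
  have hM₁0 : 0 < M₁ := by positivity
  have hwS : ∀ a ∈ s.vertex.names w, a ∈ S := fun a ha =>
    hGS (RauzyVertex.names_mem_of_staysIn hwG a ha)
  have hwc : CoveredByBlocks m k (s.vertex.names w) :=
    (CoveredByBlocks.of_length hm _).mono_length (by simpa using hwk)
  suffices H : Reach (Exits (s.run w) S m (2 + l₂) (2 * (K₁ * K₂) * M₁)) (s.run w)
      (min (p₁ * min p₂ 1) (min (c₁ / 2) 1)) by
    refine H.mono fun u hu => (Exits.append hwS hwc hu).mono le_rfl (le_of_eq ?_)
    rw [hM₁]; ring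
  rw [← WeightedVertex.run_vertex] at hδ
  have hb₁ : ∀ α, (s.run w).wt α ≤ M₁ := fun α => by
    refine (WeightedVertex.run_wt_le hM w α).trans ?_
    have : (2 : ℝ) ^ w.length ≤ 2 ^ k := pow_le_pow_right₀ one_le_two hwk
    exact mul_le_mul_of_nonneg_right this hM0.le
  have hG₁ : ∀ g ∈ G, c₁ * M₁ ≤ (s.run w).wt g := fun g hg => by
    rw [← hc₁M]
    exact (hG g hg).trans (s.wt_le_run w g)
  clear_value M₁
  generalize s.run w = t at *
  have hbig : M₁ ≤ K₁ * K₂ * M₁ :=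
    le_mul_of_one_le_left hM₁0.le (one_le_mul_of_one_le_of_one_le hK₁ hK₂)
  have hbig₁ : K₁ * M₁ ≤ K₁ * K₂ * M₁ := by
    have := mul_le_mul_of_nonneg_left hK₂ (mul_pos hK₁0 hM₁0).le
    linarith
  by_cases hT : ∃ δ, t.vertex.lastName δ ∈ S \ G
  · refine Reach.weaken ?_ (min_le_left _ _)
    have hTS : (S \ G).card < j := by
      rw [← hSj]
      exact Finset.card_lt_card ⟨Finset.sdiff_subset, fun h =>
        (Finset.mem_sdiff.1 (h (hGS hg₀))).2 hg₀⟩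
    have hTu : S \ G ≠ Finset.univ := fun h =>
      hSu (Finset.univ_subset_iff.1 (h ▸ Finset.sdiff_subset))
    refine (hE A hA (S \ G) hTS hTu t M₁ hb₁).bind (by positivity) ?_
    rintro _ ⟨x, ε, rfl, hx1, -, hx3, hx4⟩
    have hxS : ∀ a ∈ t.vertex.names x, a ∈ S := fun a ha => (Finset.mem_sdiff.1 (hx1 a ha)).1
    have hxc : CoveredByBlocks m 1 (t.vertex.names x) := by
      refine CoveredByBlocks.of_card_le ((Finset.card_le_card ?_).trans (show (S \ G).card ≤ m by
        omega))
      intro a ha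
      exact hx1 a (List.mem_toFinset.1 ha)
    by_cases hy : (t.vertex.run x).lastName ε ∈ S
    · have hyG : (t.vertex.run x).lastName ε ∈ G := by
        by_contra h
        exact hx3 (Finset.mem_sdiff.2 ⟨hy, h⟩)
      -- Some last name is still in `S \ G` at the end of the excursion. The winner there is in `G`,
      -- so this name is the loser `z`; it receives the large weight of the winner and joins `G`.
      obtain ⟨δ', hδ'⟩ := RauzyVertex.exists_lastName_mem hx1 hT
      obtain rfl : δ' = 1 - ε := by
        rcases eq_or_eq_one_sub ε δ' with rfl | h
        · exact absurd hδ' hx3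
        · exact h
      set z := (t.vertex.run x).lastName (1 - ε) with hz
      have hz' := Finset.mem_sdiff.1 hδ'
      refine Reach.weaken ?_ (min_le_left _ _)
      refine (hn A hA S (insert z G) (Finset.insert_subset hz'.1 hGS) (Finset.insert_nonempty _ _)
        hSj ?_ hSu (t.run (x ++ [ε])) (K₁ * M₁) hx4 ?_).mono fun u hu => ?_
      · have : (S \ insert z G).card < (S \ G).card := by
          refine Finset.card_lt_card ⟨Finset.sdiff_subset_sdiff le_rfl (Finset.subset_insert _ _),
            fun h => ?_⟩
          exact (Finset.mem_sdiff.1 (h hδ')).2 (Finset.mem_insert_self _ _)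
        omega
      · have hc₂ : c₁ / K₁ * (K₁ * M₁) = c₁ * M₁ := by field_simp
        rw [hc₂]
        intro g hg
        rcases Finset.mem_insert.1 hg with rfl | hg
        · rw [WeightedVertex.run_append, WeightedVertex.run_cons, WeightedVertex.run_nil]
          have h1 := (t.run x).next_wt_loser ε
          rw [WeightedVertex.run_vertex, ← hz] at h1
          rw [h1]
          have h2 := (hG₁ _ hyG).trans (t.wt_le_run x _)
          have h3 := (t.run x).wt_pos z
          linarith
        · exact (hG₁ g hg).trans (t.wt_le_run _ g)
      · refine (Exits.append (l := 2) ?_ ?_ hu).mono le_rfl ?_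
        · rw [RauzyVertex.names_append]
          intro a ha
          rcases List.mem_append.1 ha with ha | ha
          · exact hxS a ha
          · simp only [RauzyVertex.names_cons, RauzyVertex.names_nil, List.mem_singleton] at ha
            exact ha ▸ hy
        · rw [RauzyVertex.names_append]
          exact hxc.append (l' := 1) (CoveredByBlocks.of_card_le (by simpa using hm))
        · have : 0 ≤ K₁ * K₂ * M₁ := by linarith
          linarith
    · refine .attained (min_le_right _ _) ?_
      rw [List.append_nil]
      refine ⟨x, ε, rfl, hxS, hxc.mono_length (by omega), hy, fun α => (hx4 α).trans ?_⟩
      linarith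
  · push Not at hT
    have hout (δ) (h : t.vertex.lastName δ ∉ G) : t.vertex.lastName δ ∉ S := fun h' =>
      hT δ (Finset.mem_sdiff.2 ⟨h', h⟩)
    have hexit (ε) (h : t.vertex.lastName ε ∉ S) :
        Reach (fun u => Exits t S m (2 + l₂) (2 * (K₁ * K₂) * M₁) (ε :: u)) (t.next ε) 1 := by
      refine .attained le_rfl ((Exits.single h hb₁).mono (Nat.zero_le _) ?_)
      linarith
    refine Reach.weaken ?_ (min_le_right _ _)
    -- Here a last name outside `G` is outside `S`. If the other one is in `G`, its large weight
    -- makes it lose with definite probability; otherwise both arrows leave `S`.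
    by_cases hδ' : t.vertex.lastName (1 - δ) ∈ G
    · refine ((hexit δ (hout δ hδ)).step δ).weaken ?_
      rw [mul_one]
      refine (min_le_left _ _).trans ?_
      have := WeightedVertex.le_prob (ε := δ) (hG₁ _ hδ') hb₁
      rwa [mul_div_mul_right _ _ hM₁0.ne'] at this
    · refine (Reach.branch fun ε => hexit ε ?_).weaken (min_le_right _ _)
      rcases eq_or_eq_one_sub δ ε with rfl | rfl
      · exact hout _ hδ
      · exact hout _ hδ'

theorem largeExitBound {d j m : ℕ} (hm : 1 ≤ m) (hj : j ≤ m + 1) (hE : ExitBound.{u} d j) (n : ℕ) :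
    LargeExitBound.{u} d j m n := by
  induction n with
  | zero => exact fun c _ => ⟨1, 1, 0, one_pos, le_rfl, fun _ _ _ _ _ _ _ _ _ h => by omega⟩
  | succ n ih => exact ih.succ hm hj hE

/-! ### A supermartingale estimate in the style of Kerckhoff -/

section Kerckhoff

variable {A : Type*} [Fintype A] [Nonempty A]

theorem WeightedVertex.sum_next (s : WeightedVertex A) (ε : Fin 2) (T : Finset A) :
    ∑ x ∈ T, (s.next ε).wt x = ∑ x ∈ T, s.wt x +
      if s.vertex.lastName (1 - ε) ∈ T then s.wt (s.vertex.lastName ε) else 0 := by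
  have h (x) : (s.next ε).wt x = s.wt x +
      if s.vertex.lastName (1 - ε) = x then s.wt (s.vertex.lastName ε) else 0 := by
    rw [next_wt]
    by_cases hx : x = s.vertex.lastName (1 - ε)
    · simp [hx]
    · simp [hx, Ne.symm hx]
  simp_rw [h, Finset.sum_add_distrib, Finset.sum_ite_eq]

/-- Before the names of `S` are left or one of them gets a large weight, the other names
probably keep bounded weights. -/
theorem reach_exits_or_large {S : Finset A} {M L q : ℝ} (hM : 0 < M) (hML : M ≤ L)
    (n : ℕ) (s : WeightedVertex A) (hs : ∀ x, q ≤ s.wt x) (hL : ∀ x, s.wt x ≤ 2 * L)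
    (hn : Fintype.card A * L ≤ ∑ x, s.wt x + n * q) :
    Reach (fun w => Exits s S (Fintype.card A) 1 (2 * L) w ∨ ((∀ a ∈ s.vertex.names w, a ∈ S) ∧
      (∃ x ∈ S, M ≤ (s.run w).wt x) ∧ ∀ x, (s.run w).wt x ≤ 2 * L)) s
      (1 - (∑ x ∈ Sᶜ, s.wt x) / L) := by
  have hL0 : 0 < L := hM.trans_le hML
  have hF0 (t : WeightedVertex A) : 0 ≤ ∑ x ∈ Sᶜ, t.wt x :=
    Finset.sum_nonneg fun x _ => (t.wt_pos x).le
  induction n generalizing s with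
  | zero =>
    -- Each arrow adds at least `q` to the total weight, so `n` bounds the remaining time. When it
    -- is exhausted, if no name of `S` is heavy then the names outside `S` weigh at least `L`, and
    -- there is nothing to prove.
    by_cases hx : ∃ x ∈ S, M ≤ s.wt x
    · exact .attained (by linarith [div_nonneg (hF0 s) hL0.le]) (.inr ⟨by simp, hx, hL⟩)
    · push Not at hx
      refine .zero (sub_nonpos.2 ?_)
      rw [one_le_div₀ hL0]
      by_contra! hF
      have hlt : ∑ x, s.wt x < ∑ _x : A, L := by
        refine Finset.sum_lt_sum_of_nonempty Finset.univ_nonempty fun x _ => ?_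
        by_cases hxS : x ∈ S
        · exact (hx x hxS).trans_le hML
        · exact (Finset.single_le_sum (fun x _ => (s.wt_pos x).le)
            (Finset.mem_compl.2 hxS)).trans_lt hF
      rw [Finset.sum_const, Finset.card_univ, nsmul_eq_mul] at hlt
      simp only [Nat.cast_zero, zero_mul, add_zero] at hn
      linarith
  | succ n ih =>
    by_cases hx : ∃ x ∈ S, M ≤ s.wt x
    · exact .attained (by linarith [div_nonneg (hF0 s) hL0.le]) (.inr ⟨by simp, hx, hL⟩)
    push Not at hx
    by_cases hF : L ≤ ∑ x ∈ Sᶜ, s.wt x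
    · exact .zero (sub_nonpos.2 ((one_le_div₀ hL0).2 hF))
    push Not at hF
    have hsL (x) : s.wt x ≤ L := by
      by_cases hxS : x ∈ S
      · exact (hx x hxS).le.trans hML
      · exact (Finset.single_le_sum (fun x _ => (s.wt_pos x).le)
          (Finset.mem_compl.2 hxS)).trans hF.le
    refine .node (fun ε => if s.vertex.lastName ε ∈ S then
      1 - (∑ x ∈ Sᶜ, (s.next ε).wt x) / L else 1) (fun ε => ?_) ?_
    · split_ifs with hε
      · refine (ih (s.next ε) (fun x => (hs x).trans (s.wt_le_next ε x))
          (WeightedVertex.next_wt_le hsL ε) ?_).mono ?_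
        · rw [s.sum_next, if_pos (Finset.mem_univ _)]
          push_cast at hn
          linarith [hs (s.vertex.lastName ε)]
        · rintro w (hw | ⟨h1, h2⟩)
          · left
            obtain ⟨u, δ, rfl, h1, h2, h3, h4⟩ := hw
            refine ⟨ε :: u, δ, rfl, ?_, CoveredByBlocks.of_card_le (Finset.card_le_univ _), h3, h4⟩
            intro a ha
            rcases List.mem_cons.1 ha with rfl | ha
            · exact hε
            · exact h1 a ha
          · refine .inr ⟨fun a ha => ?_, h2⟩
            rcases List.mem_cons.1 ha with rfl | ha
            · exact hε
            · exact h1 a ha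
      · exact .attained le_rfl (.inl ((Exits.single hε hsL).mono (Nat.zero_le _) le_rfl))
    · set F := ∑ x ∈ Sᶜ, s.wt x with hFdef
      set a := s.vertex.lastName 0 with ha
      set b := s.vertex.lastName 1 with hb
      have hpa := s.wt_pos a
      have hpb := s.wt_pos b
      have h0 : s.prob 0 = s.wt b / (s.wt a + s.wt b) := rfl
      have h1 : s.prob 1 = s.wt a / (s.wt a + s.wt b) := by
        rw [add_comm]; rfl
      have hn0 := s.sum_next 0 Sᶜ
      have hn1 := s.sum_next 1 Sᶜ
      rw [sub_zero, ← ha, ← hb, ← hFdef] at hn0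
      rw [sub_self, ← ha, ← hb, ← hFdef] at hn1
      have hmem (x) (hx : x ∉ S) : s.wt x ≤ F :=
        Finset.single_le_sum (fun x _ => (s.wt_pos x).le) (Finset.mem_compl.2 hx)
      simp only [Finset.mem_compl] at hn0 hn1
      rw [hn0, hn1, h0, h1]
      have hne : s.wt a + s.wt b ≠ 0 := by positivity
      -- With value 0 after an exit, the total weight `F` outside `S` does not increase on average:
      -- if `a ∈ S` and `b ∉ S`, then `F` becomes `F + wt a` with probability `wt b / (wt a + wt b)`
      -- and 0 otherwise, with mean at most `F` because `wt b ≤ F`.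
      have key (X Y : ℝ) (h : 0 ≤ F * (s.wt a + s.wt b) - s.wt b * X - s.wt a * Y) :
          1 - F / L ≤ s.wt b / (s.wt a + s.wt b) * (1 - X / L) +
            s.wt a / (s.wt a + s.wt b) * (1 - Y / L) := by
        have : s.wt b / (s.wt a + s.wt b) * (1 - X / L) +
            s.wt a / (s.wt a + s.wt b) * (1 - Y / L) - (1 - F / L) =
            (F * (s.wt a + s.wt b) - s.wt b * X - s.wt a * Y) / ((s.wt a + s.wt b) * L) := by
          field_simp
          ring
        have h2 := div_nonneg h (mul_pos (add_pos hpa hpb) hL0).le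
        linarith
      by_cases haS : a ∈ S <;> by_cases hbS : b ∈ S
      · simp only [haS, hbS, if_true, not_true, if_false]
        exact key _ _ (le_of_eq (by ring))
      · have := hmem b hbS
        simp only [haS, hbS, if_true, not_false_iff, if_false]
        have := key (F + s.wt a) 0 (by nlinarith)
        simpa using this
      · have := hmem a haS
        simp only [haS, hbS, if_true, not_false_iff, if_false]
        have := key 0 (F + s.wt b) (by nlinarith)
        simpa using this
      · have := key 0 0 (by have := hF0 s; rw [← hFdef] at this; simp; positivity)
        simpa [haS, hbS] using this

end Kerckhoff

/-- Induction on the size of the set: the supermartingale estimate provides an exit or a heavy name,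
and in the second case `largeExitBound` applies, since it needs the bound for smaller sets only. No
economy of names is required, so blocks may have `d` names. -/
theorem exitBound (d j : ℕ) (hj : j ≤ d) : ExitBound.{u} d j := by
  induction j with
  | zero => exact ⟨1, 1, one_pos, le_rfl, fun A _ _ _ S h => by omega⟩
  | succ j ih =>
    have hE := ih (by omega)
    have hd : (1 : ℝ) ≤ d := by exact_mod_cast (by omega : 1 ≤ d)
    obtain ⟨p₂, K₂, l₂, hp₂, hK₂, h₂⟩ := largeExitBound (m := d) (by omega) (by omega) hE (j + 1)
      (1 / (4 * d)) (by positivity)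
    obtain ⟨p₁, K₁, hp₁, hK₁, h₁⟩ := hE
    refine ⟨min p₁ (1 / 2 * min p₂ 1), max K₁ (K₂ * (4 * d)), by positivity,
      hK₁.trans (le_max_left _ _), ?_⟩
    intro A _ _ hA S hSj hSu s M hM
    have hM0 : 0 < M := (s.wt_pos (s.vertex.lastName 0)).trans_le (hM _)
    rcases Nat.lt_succ_iff_lt_or_eq.1 hSj with hlt | heq
    · refine ((h₁ A hA S hlt hSu s M hM).weaken (min_le_left _ _)).mono fun w hw =>
        hw.mono le_rfl ?_
      gcongr
      exact le_max_left _ _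
    refine Reach.weaken ?_ (min_le_right _ _)
    have hbig : K₂ * (4 * d * M) ≤ max K₁ (K₂ * (4 * d)) * M := by
      rw [← mul_assoc]
      gcongr
      exact le_max_right _ _
    have hbig' : 2 * (2 * d * M) ≤ max K₁ (K₂ * (4 * d)) * M := by
      refine le_trans ?_ hbig
      have : 0 < 4 * d * M := by positivity
      nlinarith
    obtain ⟨x₀, -, hx₀⟩ := Finset.exists_min_image Finset.univ s.wt Finset.univ_nonempty
    have hq := s.wt_pos x₀
    obtain ⟨n, hn⟩ := exists_nat_ge (Fintype.card A * (2 * d * M) / s.wt x₀)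
    -- The weights outside `S` add up to at most `d * M`, half of this `L`, hence the probability
    -- 1/2. Weights end up below `2 * L = 4 * d * M`, hence the proportion `1 / (4 * d)` for a name
    -- of weight at least `M`.
    have hR := reach_exits_or_large (S := S) (L := 2 * d * M) hM0 (by nlinarith) n s
      (fun x => hx₀ x (Finset.mem_univ x)) (fun x => (hM x).trans (by nlinarith)) (by
        rw [div_le_iff₀ hq] at hn
        have : 0 ≤ ∑ x, s.wt x := Finset.sum_nonneg fun x _ => (s.wt_pos x).le
        linarith)
    rw [hA] at hR
    have hhalf : 1 / 2 ≤ 1 - (∑ x ∈ Sᶜ, s.wt x) / (2 * d * M) := by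
      have h3 : ∑ x ∈ Sᶜ, s.wt x ≤ d * M := by
        calc _ ≤ ∑ x, s.wt x := Finset.sum_le_univ_sum_of_nonneg fun x => (s.wt_pos x).le
          _ ≤ ∑ _x : A, M := Finset.sum_le_sum fun x _ => hM x
          _ = d * M := by simp [hA]
      have h4 : (∑ x ∈ Sᶜ, s.wt x) / (2 * d * M) ≤ 1 / 2 := by
        rw [div_le_iff₀ (by positivity)]
        linarith
      linarith
    refine (hR.weaken hhalf).bind (by positivity) ?_
    rintro w (hw | ⟨hw, ⟨x, hxS, hx⟩, hwL⟩)
    · refine .attained (min_le_right _ _) ?_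
      rw [List.append_nil]
      exact hw.mono le_rfl hbig'
    · refine ((h₂ A hA S {x} (by simpa using hxS) (Finset.singleton_nonempty x) heq ?_ hSu
        (s.run w) (4 * d * M) (fun α => (hwL α).trans (by linarith)) ?_).weaken
        (min_le_left _ _)).mono ?_
      · exact (Finset.card_le_card Finset.sdiff_subset).trans_lt hSj
      · intro g hg
        rw [Finset.mem_singleton.1 hg]
        refine le_trans (le_of_eq ?_) hx
        field_simp
      · intro u hu
        obtain ⟨y, ε, h1, h2, h3, h4, h5⟩ := Exits.append (m := d) (l := 1) hw
          (CoveredByBlocks.of_card_le (hA ▸ Finset.card_le_univ _)) hu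
        exact ⟨y, ε, h1, h2, CoveredByBlocks.of_card_le (hA ▸ Finset.card_le_univ _), h4,
          fun α => (h5 α).trans hbig⟩


/-! ### Comparison of weights after a path with at least two names -/

section Balance

variable {A : Type*} [Fintype A] [Nonempty A]

/-- The weights after arrows of type `ε` only, starting from weights `1`: the losers lose in turn,
in the cyclic order given by their positions. -/
structure SingleWinner (s : WeightedVertex A) (ε : Fin 2) : Prop where
  eq_one : ∀ x, s.vertex.pos (1 - ε) x ≤ s.vertex.pos (1 - ε) (s.vertex.lastName ε) → s.wt x = 1
  anti : ∀ x y, s.vertex.pos (1 - ε) (s.vertex.lastName ε) < s.vertex.pos (1 - ε) x →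
    s.vertex.pos (1 - ε) x < s.vertex.pos (1 - ε) y → s.wt y ≤ s.wt x ∧ s.wt x ≤ s.wt y + 1

/-- The weights after a path with winners in `S`, the last one of type `ε`, which uses at least two
names: the loser `z` of the last change of winner loses at least as often as the other names. -/
structure BalancedWeights (S : Finset A) (s : WeightedVertex A) (ε : Fin 2) : Prop where
  mem : s.vertex.lastName ε ∈ S
  exists_loser : ∃ z ∈ S,
    s.vertex.pos (1 - ε) (s.vertex.lastName ε) < s.vertex.pos (1 - ε) z ∧
    ∀ b ∉ S, s.wt b ≤ ∑ x ∈ S, s.wt x ∧ (s.vertex.pos (1 - ε) z < s.vertex.pos (1 - ε) b →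
      s.wt b + s.wt (s.vertex.lastName ε) ≤ ∑ x ∈ S, s.wt x)

theorem SingleWinner.of_wt_eq_one {s : WeightedVertex A} (h : ∀ x, s.wt x = 1) (ε : Fin 2) :
    SingleWinner s ε :=
  ⟨fun x _ => h x, fun x y _ _ => by simp [h]⟩

theorem RauzyVertex.pos_lt_pos_lastName {v : RauzyVertex A} {δ : Fin 2} {x : A}
    (hx : x ≠ v.lastName δ) : v.pos δ x < v.pos δ (v.lastName δ) := by
  rw [ne_eq, ← pos_succ_eq_iff] at hx
  have := v.pos_lt δ x
  rw [pos_lastName]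
  omega

/-- The last name of the other row gains 1, the weight of the winner, and moves just after the
winner: the names on the right of the winner rotate, each losing once per turn. -/
theorem SingleWinner.next (hA : 1 < Fintype.card A) {s : WeightedVertex A} {ε : Fin 2}
    (h : SingleWinner s ε) : SingleWinner (s.next ε) ε := by
  set a := s.vertex.lastName ε with ha
  set l := s.vertex.lastName (1 - ε) with hl
  have hal : s.vertex.pos (1 - ε) a < s.vertex.pos (1 - ε) l :=
    RauzyVertex.pos_lt_pos_lastName (s.vertex.lastName_ne hA ε)
  have ha1 : s.wt a = 1 := h.eq_one a le_rfl
  have hpos := fun x => s.vertex.pos_op_other ε x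
  simp only [← ha, ← hl] at hpos
  have hwt := fun x => s.next_wt ε x
  simp only [← ha, ← hl] at hwt
  constructor
  · intro x hx
    rw [WeightedVertex.next_vertex, RauzyVertex.lastName_op_self, ← ha, hpos, hpos,
      if_pos le_rfl] at hx
    rw [hwt]
    by_cases h1 : s.vertex.pos (1 - ε) x ≤ s.vertex.pos (1 - ε) a
    · rw [if_neg (by rintro rfl; omega)]
      exact h.eq_one x h1
    · rw [if_neg h1] at hx
      split_ifs at hx <;> omega
  · intro x y hx hxy
    rw [WeightedVertex.next_vertex, RauzyVertex.lastName_op_self, ← ha, hpos a, if_pos le_rfl] at hx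
    rw [WeightedVertex.next_vertex] at hxy
    have hx' : s.vertex.pos (1 - ε) a < s.vertex.pos (1 - ε) x := by
      by_contra! hc
      rw [hpos x, if_pos hc] at hx
      omega
    have hy' : s.vertex.pos (1 - ε) a < s.vertex.pos (1 - ε) y := by
      by_contra! hc
      rw [hpos y, if_pos hc] at hxy
      omega
    rw [hpos x, hpos y, if_neg (not_le.2 hx'), if_neg (not_le.2 hy')] at hxy
    by_cases hyl : y = l
    · rw [if_pos hyl] at hxy
      split_ifs at hxy <;> omega
    rw [if_neg hyl] at hxy
    rw [hwt x, hwt y, if_neg hyl]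
    by_cases hxl : x = l
    · rw [if_pos hxl, ha1]
      have := h.anti y l hy' (RauzyVertex.pos_lt_pos_lastName hyl)
      constructor <;> linarith
    · rw [if_neg hxl] at hxy ⊢
      exact h.anti x y hx' (by omega)

/-- At the first change of winner, `a` has weight 1 and gains `wt l`, so the total weight of `S`
becomes at least `1 + 2 * wt l`, while a name outside `S` weighs at most `wt l + 1`. -/
theorem SingleWinner.balanced (hA : 1 < Fintype.card A) {S : Finset A} {s : WeightedVertex A}
    {ε : Fin 2} (h : SingleWinner s ε) (ha : s.vertex.lastName ε ∈ S)
    (hl : s.vertex.lastName (1 - ε) ∈ S) : BalancedWeights S (s.next (1 - ε)) (1 - ε) := by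
  have hε := one_sub_one_sub_self ε
  set a := s.vertex.lastName ε with ha'
  set l := s.vertex.lastName (1 - ε) with hl'
  have hne : a ≠ l := s.vertex.lastName_ne hA ε
  have ha1 : s.wt a = 1 := h.eq_one a le_rfl
  have hal : s.vertex.pos ε l < s.vertex.pos ε a := RauzyVertex.pos_lt_pos_lastName hne.symm
  have hsum := s.sum_next (1 - ε) S
  rw [hε, ← ha', ← hl', if_pos ha] at hsum
  refine ⟨by rwa [WeightedVertex.next_vertex, RauzyVertex.lastName_op_self], a, ha, ?_, ?_⟩
  · have hpos := fun x => s.vertex.pos_op_other (1 - ε) x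
    simp only [hε, ← ha', ← hl'] at hpos
    rw [WeightedVertex.next_vertex, RauzyVertex.lastName_op_self, ← hl', hε, hpos, hpos,
      if_pos le_rfl, if_neg (by omega), if_pos rfl]
    omega
  · intro b hb
    rw [WeightedVertex.next_vertex, RauzyVertex.lastName_op_self, ← hl']
    have hbl : b ≠ l := fun h => hb (h ▸ hl)
    have hba : b ≠ a := fun h => hb (h ▸ ha)
    have h2 : s.wt a + s.wt l ≤ ∑ x ∈ S, s.wt x := by
      rw [← Finset.sum_pair hne]
      refine Finset.sum_le_sum_of_subset_of_nonneg ?_ fun x _ _ => (s.wt_pos x).le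
      intro x hx
      rcases Finset.mem_insert.1 hx with rfl | hx
      · exact ha
      · exact Finset.mem_singleton.1 hx ▸ hl
    have hlpos := s.wt_pos l
    have hb1 : s.wt b ≤ s.wt l + 1 := by
      by_cases hc : s.vertex.pos (1 - ε) b ≤ s.vertex.pos (1 - ε) a
      · rw [h.eq_one b hc]; linarith
      · exact (h.anti b l (not_le.1 hc) (RauzyVertex.pos_lt_pos_lastName hbl)).2
    rw [s.next_wt_of_ne _ (by rwa [hε]), hsum, s.next_wt_of_ne _ (by rw [hε]; exact hne.symm)]
    exact ⟨by linarith, fun _ => by linarith⟩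

/-- A name `b ∉ S` that loses lies to the right of `z`, so the reserve `wt a` pays for its gain; it
then moves to the left of `z`, where no reserve is required. It can be on the right of `z` again
only after `z` has lost, which adds `wt a` to the total weight of `S`. -/
theorem BalancedWeights.next_self (hA : 1 < Fintype.card A) {S : Finset A} {s : WeightedVertex A}
    {ε : Fin 2} (h : BalancedWeights S s ε) : BalancedWeights S (s.next ε) ε := by
  obtain ⟨ha, z, hz, haz, h⟩ := h
  have hpos := fun x => s.vertex.pos_op_other ε x
  have hwt := fun x => s.next_wt ε x
  have hsum := s.sum_next ε S
  have hne := s.vertex.lastName_ne hA ε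
  have hlast := fun x => RauzyVertex.pos_lt_pos_lastName (v := s.vertex) (δ := 1 - ε) (x := x)
  set a := s.vertex.lastName ε with ha'
  set l := s.vertex.lastName (1 - ε) with hl'
  have hapos := s.wt_pos a
  refine ⟨by rwa [WeightedVertex.next_vertex, RauzyVertex.lastName_op_self], z, hz, ?_, ?_⟩
  · rw [WeightedVertex.next_vertex, RauzyVertex.lastName_op_self, ← ha', hpos, hpos, if_pos le_rfl,
      if_neg (by omega)]
    split_ifs <;> omega
  · intro b hb
    obtain ⟨hb1, hb2⟩ := h b hb
    have hzb : z ≠ b := fun h => hb (h ▸ hz)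
    have hab : a ≠ b := fun h => hb (h ▸ ha)
    rw [WeightedVertex.next_vertex, RauzyVertex.lastName_op_self, ← ha', hwt a, if_neg hne, hsum,
      hwt b]
    by_cases hbl : b = l
    · have hlS : l ∉ S := hbl ▸ hb
      have hzl := hlast z (fun h => hzb (h.trans hbl.symm))
      rw [if_pos hbl, if_neg hlS, add_zero]
      rw [hbl] at hb2
      have := hb2 hzl
      refine ⟨by linarith, fun hlt => ?_⟩
      rw [hpos, hpos, if_neg (by omega), if_neg (fun h => hzb (h.trans hbl.symm)),
        if_neg (by rw [hbl]; omega), if_pos hbl] at hlt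
      omega
    · rw [if_neg hbl]
      refine ⟨by split_ifs <;> linarith, fun hlt => ?_⟩
      by_cases hlS : l ∈ S
      · rw [if_pos hlS]; linarith
      · rw [if_neg hlS, add_zero]
        refine hb2 ?_
        rw [hpos, hpos, if_neg (by omega), if_neg (fun h : z = l => hlS (h ▸ hz)), if_neg hbl] at hlt
        split_ifs at hlt <;> omega

/-- The former winner `a` now loses and becomes the new `z`. The total weight of `S` increases by
the weight of the new winner, which provides the reserve for every `b ∉ S`. -/
theorem BalancedWeights.next_one_sub (hA : 1 < Fintype.card A) {S : Finset A} {s : WeightedVertex A}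
    {ε : Fin 2} (h : BalancedWeights S s ε) (hl : s.vertex.lastName (1 - ε) ∈ S) :
    BalancedWeights S (s.next (1 - ε)) (1 - ε) := by
  obtain ⟨ha, z, hz, haz, h⟩ := h
  have hε := one_sub_one_sub_self ε
  have hne := s.vertex.lastName_ne hA ε
  have hpos := fun x => s.vertex.pos_op_other (1 - ε) x
  have hsum := s.sum_next (1 - ε) S
  have hal := RauzyVertex.pos_lt_pos_lastName (v := s.vertex) hne.symm
  simp only [hε] at hpos hsum
  set a := s.vertex.lastName ε with ha'
  set l := s.vertex.lastName (1 - ε) with hl'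
  rw [if_pos ha] at hsum
  have hlpos := s.wt_pos l
  refine ⟨by rwa [WeightedVertex.next_vertex, RauzyVertex.lastName_op_self], a, ha, ?_, ?_⟩
  · rw [WeightedVertex.next_vertex, RauzyVertex.lastName_op_self, ← hl', hε, hpos, hpos,
      if_pos le_rfl, if_neg (by omega), if_pos rfl]
    omega
  · intro b hb
    have hba : b ≠ a := fun h => hb (h ▸ ha)
    obtain ⟨hb1, -⟩ := h b hb
    rw [WeightedVertex.next_vertex, RauzyVertex.lastName_op_self, ← hl',
      s.next_wt_of_ne _ (by rwa [hε]), hsum, s.next_wt_of_ne _ (by rw [hε]; exact hne.symm)]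
    exact ⟨by linarith, fun _ => by linarith⟩

theorem BalancedWeights.run (hA : 1 < Fintype.card A) {S : Finset A} {s : WeightedVertex A} {ε : Fin 2}
    (h : BalancedWeights S s ε) (w : List (Fin 2)) (hw : ∀ a ∈ s.vertex.names w, a ∈ S) :
    ∃ δ, BalancedWeights S (s.run w) δ := by
  induction w generalizing s ε with
  | nil => exact ⟨ε, h⟩
  | cons δ w ih =>
    have hw' : ∀ a ∈ (s.next δ).vertex.names w, a ∈ S := fun a ha =>
      hw a (List.mem_cons_of_mem _ ha)
    rcases eq_or_eq_one_sub ε δ with rfl | rfl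
    · exact ih (h.next_self hA) hw'
    · exact ih (h.next_one_sub hA (hw _ List.mem_cons_self)) hw'

theorem SingleWinner.run (hA : 1 < Fintype.card A) {S : Finset A} {s : WeightedVertex A}
    {ε : Fin 2} (h : SingleWinner s ε) (ha : s.vertex.lastName ε ∈ S) (w : List (Fin 2))
    (hw : ∀ a ∈ s.vertex.names w, a ∈ S) :
    (∀ a ∈ s.vertex.names w, a = s.vertex.lastName ε) ∨ ∃ δ, BalancedWeights S (s.run w) δ := by
  induction w generalizing s with
  | nil => simp
  | cons δ w ih =>
    have hw' : ∀ a ∈ (s.next δ).vertex.names w, a ∈ S := fun a ha =>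
      hw a (List.mem_cons_of_mem _ ha)
    rcases eq_or_eq_one_sub ε δ with rfl | rfl
    · have hlast := s.vertex.lastName_op_self δ
      rcases ih (h.next hA) (by rwa [WeightedVertex.next_vertex, hlast]) hw' with h' | h'
      · left
        intro a ha
        rcases List.mem_cons.1 ha with rfl | ha
        · rfl
        · rw [h' a ha, WeightedVertex.next_vertex, hlast]
      · exact .inr h'
    · exact .inr ((h.balanced hA ha (hw _ List.mem_cons_self)).run hA w hw')

/-- After a path with at least two names, starting from weights `1`, the weights are at most
the total weight of the names of the path. -/
theorem WeightedVertex.wt_run_le_sum (hA : 1 < Fintype.card A) {S : Finset A}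
    {s : WeightedVertex A} (hs : ∀ x, s.wt x = 1) (w : List (Fin 2))
    (hw : (s.vertex.names w).toFinset = S) (hS : 1 < S.card) (b : A) :
    (s.run w).wt b ≤ ∑ x ∈ S, (s.run w).wt x := by
  by_cases hb : b ∈ S
  · exact Finset.single_le_sum (fun x _ => ((s.run w).wt_pos x).le) hb
  have hw' : ∀ a ∈ s.vertex.names w, a ∈ S := fun a ha => hw ▸ List.mem_toFinset.2 ha
  cases w with
  | nil => subst hw; simp at hS
  | cons ε w =>
    rcases (SingleWinner.of_wt_eq_one hs ε).run hA (hw' _ List.mem_cons_self) _ hw' with h | ⟨δ, h⟩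
    · have : S ⊆ {s.vertex.lastName ε} := fun a ha => by
        rw [← hw, List.mem_toFinset] at ha
        exact Finset.mem_singleton.2 (h a ha)
      have := Finset.card_le_card this
      rw [Finset.card_singleton] at this
      omega
    · obtain ⟨-, z, -, -, h⟩ := h
      exact (h b hb).1

end Balance


/-! ### Words followed by an interval exchange map, and length matrices -/

namespace IEM

variable {A : Type*} [Fintype A] [Nonempty A]

theorem ext_of {T T' : IEM A} (hv : T.vertex = T'.vertex) (hl : ∀ α, T.len α = T'.len α) :
    T = T' := by
  cases T; cases T'
  obtain rfl : _ = _ := hv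
  obtain rfl : _ = _ := funext hl
  rfl

/-- The arrows followed by `T` have the types listed in the word. -/
def Follows : IEM A → List (Fin 2) → Prop
  | _, [] => True
  | T, ε :: w => ∃ h : T.Wins ε, (T.step ε h).Follows w

theorem next_of_wins {T : IEM A} {ε : Fin 2} (h : T.Wins ε) : T.next = some (T.step ε h) := by
  obtain rfl | rfl : ε = 0 ∨ ε = 1 := by omega
  · rw [next, dif_pos h]
  · have h0 : ¬T.Wins 0 := lt_asymm h
    rw [next, dif_neg h0, dif_pos h]

theorem firstArrow_eq_some {T : IEM A} {ε : Fin 2} :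
    T.firstArrow = some ⟨T.vertex, ε⟩ ↔ T.Wins ε := by
  obtain rfl | rfl : ε = 0 ∨ ε = 1 := by omega
  · unfold firstArrow
    split_ifs with h h' <;> simp [h]
  · unfold firstArrow
    split_ifs with h h'
    · have h1 : ¬T.Wins 1 := lt_asymm h
      simpa using h1
    · simpa using h'
    · simpa using h'

theorem iter_succ' (T : IEM A) (n : ℕ) : T.iter (n + 1) = T.next.bind fun T' => T'.iter n := by
  induction n with
  | zero => simp [iter]
  | succ n ih =>
    rw [iter, ih, Option.bind_assoc]
    rfl

theorem arrow_succ_succ {T : IEM A} {ε : Fin 2} (h : T.Wins ε) (n : ℕ) :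
    T.arrow (n + 2) = (T.step ε h).arrow (n + 1) := by
  rw [arrow, iter_succ', next_of_wins h]
  rfl

theorem follows_iff (T : IEM A) (u : List (Fin 2)) :
    T.Follows u ↔ ∀ (i : ℕ) (h : i < u.length),
      T.arrow (i + 1) = some ⟨T.vertex.run (u.take i), u[i]⟩ := by
  induction u generalizing T with
  | nil => simp [Follows]
  | cons ε u ih =>
    have h0 : T.arrow (0 + 1) = T.firstArrow := rfl
    constructor
    · rintro ⟨h, hu⟩ i hi
      cases i with
      | zero => rw [h0]; exact firstArrow_eq_some.2 h
      | succ i =>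
        rw [arrow_succ_succ h, (ih _).1 hu i (by simpa using hi)]
        rfl
    · intro hu
      have h : T.Wins ε := firstArrow_eq_some.1 (hu 0 (by simp))
      refine ⟨h, (ih _).2 fun i hi => ?_⟩
      rw [← arrow_succ_succ h, hu (i + 1) (by simpa using hi)]
      rfl

theorem Follows.of_append {T : IEM A} {u w : List (Fin 2)} (h : T.Follows (u ++ w)) :
    T.Follows u := by
  rw [follows_iff] at h ⊢
  intro i hi
  rw [h i (by simp; omega), List.take_append_of_le_length hi.le, List.getElem_append_left hi]

theorem Follows.eq_of_append {T : IEM A} {u : List (Fin 2)} {ε δ : Fin 2}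
    (h : T.Follows (u ++ [ε])) (h' : T.Follows (u ++ [δ])) : ε = δ := by
  rw [follows_iff] at h h'
  have h1 := h u.length (by simp)
  rw [h' u.length (by simp)] at h1
  simpa using h1.symm

end IEM

namespace RauzyVertex

variable {A : Type*} [Fintype A] [Nonempty A]

/-- The matrix which gives the initial lengths in terms of the lengths at the end of a path. -/
def lengthMatrix : RauzyVertex A → List (Fin 2) → Matrix A A ℝ
  | _, [] => 1
  | v, ε :: w =>
    Matrix.transvection (v.lastName ε) (v.lastName (1 - ε)) 1 * lengthMatrix (v.op ε) w

theorem det_lengthMatrix (hA : 1 < Fintype.card A) (v : RauzyVertex A) (w : List (Fin 2)) :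
    (v.lengthMatrix w).det = 1 := by
  induction w generalizing v with
  | nil => simp [lengthMatrix]
  | cons ε w ih =>
    rw [lengthMatrix, Matrix.det_mul, ih,
      Matrix.det_transvection_of_ne _ _ (v.lastName_ne hA ε), one_mul]

theorem transvection_mulVec (i j : A) (x : A → ℝ) (k : A) :
    (Matrix.transvection i j (1 : ℝ)).mulVec x k = x k + if k = i then x j else 0 := by
  rw [Matrix.transvection, Matrix.add_mulVec, Matrix.one_mulVec, Pi.add_apply,
    Matrix.single_mulVec]
  by_cases h : k = i
  · subst h; simp
  · simp [h]

theorem lengthMatrix_mulVec_pos (v : RauzyVertex A) (w : List (Fin 2)) {x : A → ℝ}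
    (hx : ∀ α, 0 < x α) (α : A) : 0 < (v.lengthMatrix w).mulVec x α := by
  induction w generalizing v α with
  | nil => simpa [lengthMatrix] using hx α
  | cons ε w ih =>
    rw [lengthMatrix, ← Matrix.mulVec_mulVec, transvection_mulVec]
    have h1 := ih (v.op ε) α
    have h2 := ih (v.op ε) (v.lastName (1 - ε))
    split_ifs <;> linarith

/-- The weights evolve dually to the lengths. Starting from weights 1, they are the column sums of
the length matrix. -/
theorem sum_wt_mul_lengthMatrix_mulVec (s : WeightedVertex A) (w : List (Fin 2)) (x : A → ℝ) :
    ∑ α, s.wt α * (s.vertex.lengthMatrix w).mulVec x α = ∑ α, (s.run w).wt α * x α := by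
  induction w generalizing s with
  | nil => simp [lengthMatrix]
  | cons ε w ih =>
    rw [WeightedVertex.run_cons, ← ih, lengthMatrix, ← Matrix.mulVec_mulVec]
    simp only [WeightedVertex.next_vertex]
    set y := (lengthMatrix (s.vertex.op ε) w).mulVec x
    simp_rw [transvection_mulVec, mul_add, Finset.sum_add_distrib, mul_ite, mul_zero,
      Finset.sum_ite_eq', Finset.mem_univ, if_true]
    have h (α) : (s.next ε).wt α * y α = s.wt α * y α +
        if α = s.vertex.lastName (1 - ε) then s.wt (s.vertex.lastName ε) * y α else 0 := by
      rw [WeightedVertex.next_wt]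
      split_ifs with hα
      · rw [hα]; ring
      · ring
    simp_rw [h, Finset.sum_add_distrib, Finset.sum_ite_eq', Finset.mem_univ, if_true]

end RauzyVertex

/-- Each transvection adds the loser's length back to the winner's, so it inverts a basic operation;
positivity of the lengths after it is exactly the inequality that allows the operation. -/
theorem IEM.follows_iff_exists {A : Type*} [Fintype A] [Nonempty A] (hA : 1 < Fintype.card A)
    (T : IEM A) (u : List (Fin 2)) :
    T.Follows u ↔ ∃ x : A → ℝ, (∀ α, 0 < x α) ∧ T.len = (T.vertex.lengthMatrix u).mulVec x := by
  induction u generalizing T with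
  | nil =>
    simp only [Follows, RauzyVertex.lengthMatrix, Matrix.one_mulVec, true_iff]
    exact ⟨T.len, T.len_pos, rfl⟩
  | cons ε u ih =>
    have hne := T.vertex.lastName_ne hA ε
    constructor
    · rintro ⟨h, hu⟩
      obtain ⟨x, hx, hT⟩ := (ih _).1 hu
      refine ⟨x, hx, ?_⟩
      rw [RauzyVertex.lengthMatrix, ← Matrix.mulVec_mulVec]
      change _ = Matrix.mulVec _ ((RauzyVertex.lengthMatrix (T.step ε h).vertex u).mulVec x)
      rw [← hT]
      ext α
      rw [RauzyVertex.transvection_mulVec]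
      simp only [step, if_neg hne.symm]
      by_cases hα : α = T.vertex.lastName ε
      · simp [hα]
      · simp [hα]
    · rintro ⟨x, hx, hT⟩
      rw [RauzyVertex.lengthMatrix, ← Matrix.mulVec_mulVec] at hT
      set y := ((T.vertex.op ε).lengthMatrix u).mulVec x with hy
      have hlen (α) := congrFun hT α
      simp only [RauzyVertex.transvection_mulVec] at hlen
      have h : T.Wins ε := by
        rw [Wins, hlen, hlen, if_neg hne.symm, if_pos rfl]
        have := RauzyVertex.lengthMatrix_mulVec_pos (T.vertex.op ε) u hx (T.vertex.lastName ε)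
        rw [← hy] at this
        linarith
      refine ⟨h, (ih _).2 ⟨x, hx, ?_⟩⟩
      change _ = y
      ext α
      simp only [step, hlen, if_neg hne.symm, if_true]
      by_cases hα : α = T.vertex.lastName ε
      · simp [hα]
      · simp [hα]

/-! ### Volume of images under maps that preserve total length -/

section Volume

variable {A : Type*} [Fintype A]

/-- A linear map which preserves the sum of the coordinates acts on the volume in the hyperplane
where this sum is `1` by its determinant. -/
theorem simplexVolume_image_linearMap [Nonempty A]
    (f : EuclideanSpace ℝ A →ₗ[ℝ] EuclideanSpace ℝ A) (hf : ∀ x, ∑ α, f x α = ∑ α, x α)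
    {S : Set (EuclideanSpace ℝ A)} (hS : ∀ x ∈ S, ∑ α, x α = 1) :
    simplexVolume A (f '' S) = ENNReal.ofReal |LinearMap.det f| * simplexVolume A S := by
  let σ : EuclideanSpace ℝ A →ₗ[ℝ] ℝ :=
    { toFun := fun x => ∑ α, x α
      map_add' := fun x y => by simp [Finset.sum_add_distrib]
      map_smul' := fun c x => by simp [Finset.mul_sum] }
  have hσ (x) : σ x = ∑ α, x α := rfl
  have hfσ (x) : σ (f x) = σ x := hf x
  let x₀ : EuclideanSpace ℝ A := EuclideanSpace.single (Classical.arbitrary A) 1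
  have hx₀ : σ x₀ = 1 := by simp [hσ, x₀]
  set H := LinearMap.ker σ with hH
  have hrank : (Fintype.card A : ℝ) - 1 = (Module.finrank ℝ H : ℝ) := by
    have h1 := σ.finrank_range_add_finrank_ker
    have h2 : LinearMap.range σ = ⊤ := by
      refine LinearMap.range_eq_top.2 fun c => ⟨c • x₀, ?_⟩
      rw [map_smul, hx₀, smul_eq_mul, mul_one]
    rw [h2, finrank_top, Module.finrank_self, finrank_euclideanSpace, ← hH] at h1
    rw [← h1]; push_cast; ring
  have hfH : H ≤ H.comap f := fun x hx => by
    rw [Submodule.mem_comap, hH, LinearMap.mem_ker, hfσ]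
    exact hx
  -- As `f` preserves the sum, it induces the identity on the quotient by `H`.
  have hdet : LinearMap.det f = LinearMap.det (f.restrict hfH) := by
    rw [LinearMap.det_eq_det_mul_det H f hfH]
    have : H.mapQ H f hfH = LinearMap.id := by
      refine Submodule.linearMap_qext _ (LinearMap.ext fun x => ?_)
      simp only [LinearMap.comp_apply, Submodule.mkQ_apply, Submodule.mapQ_apply, LinearMap.id_apply]
      rw [Submodule.Quotient.eq, hH, LinearMap.mem_ker, map_sub, hfσ, sub_self]
    rw [this, LinearMap.det_id, mul_one]
  -- On translates of `H` the volume is the Hausdorff measure of `H` in its own dimension, a Haar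
  -- measure, for which the determinant formula holds.
  have hvol (y : EuclideanSpace ℝ A) (R : Set H) :
      simplexVolume A ((fun h : H => y + (h : EuclideanSpace ℝ A)) '' R) =
        Measure.hausdorffMeasure (Module.finrank ℝ H : ℝ) R := by
    rw [simplexVolume, hrank]
    refine Isometry.hausdorffMeasure_image ?_ (Or.inl (Nat.cast_nonneg _)) R
    exact (IsometryEquiv.addLeft y).isometry.comp isometry_subtype_coe
  let R : Set H := {h | x₀ + (h : EuclideanSpace ℝ A) ∈ S}
  have h1 : S = (fun h : H => x₀ + (h : EuclideanSpace ℝ A)) '' R := by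
    ext x
    constructor
    · intro hx
      have hmem : x - x₀ ∈ H := by
        rw [hH, LinearMap.mem_ker, map_sub, hx₀, hσ, hS x hx, sub_self]
      exact ⟨⟨x - x₀, hmem⟩, by simpa [R] using hx, by simp⟩
    · rintro ⟨h, hh, rfl⟩
      exact hh
  have h2 : f '' S = (fun h : H => f x₀ + (h : EuclideanSpace ℝ A)) '' (f.restrict hfH '' R) := by
    rw [h1, Set.image_image, Set.image_image]
    refine Set.image_congr fun h _ => ?_
    rw [map_add]
    rfl
  rw [h2, hvol, hdet, Measure.addHaar_image_linearMap]
  conv_rhs => rw [h1, hvol]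

end Volume

/-! ### Volumes of simplices of words, and the link with probabilities -/

section WordSimplex

variable {A : Type*} [Fintype A] [Nonempty A]

/-- The simplex of the lengths, of total length `1`, for which a given word is followed. -/
def wordSimplex (v : RauzyVertex A) (u : List (Fin 2)) : Set (EuclideanSpace ℝ A) :=
  {x | ∃ T : IEM A, T.vertex = v ∧ (∀ α, T.len α = x α) ∧ ∑ α, T.len α = 1 ∧ T.Follows u}

/-- The vertex `v` with all weights equal to `1`. -/
def RauzyVertex.unitWeights (v : RauzyVertex A) : WeightedVertex A := ⟨v, 1, fun _ => one_pos⟩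

/-- The affine parametrization of the simplex of a word by the standard simplex. -/
def wordMap (v : RauzyVertex A) (u : List (Fin 2)) :
    EuclideanSpace ℝ A →ₗ[ℝ] EuclideanSpace ℝ A :=
  Matrix.toLpLin 2 2
    (v.lengthMatrix u * Matrix.diagonal fun α => ((v.unitWeights.run u).wt α)⁻¹)

theorem wordMap_apply (v : RauzyVertex A) (u : List (Fin 2)) (x : EuclideanSpace ℝ A) (α : A) :
    wordMap v u x α =
      (v.lengthMatrix u).mulVec (fun β => ((v.unitWeights.run u).wt β)⁻¹ * x β) α := by
  rw [wordMap, Matrix.toLpLin_apply, ← Matrix.mulVec_mulVec]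
  change (v.lengthMatrix u).mulVec _ α = _
  congr 1
  ext β
  rw [Matrix.mulVec_diagonal]

theorem det_wordMap (hA : 1 < Fintype.card A) (v : RauzyVertex A) (u : List (Fin 2)) :
    LinearMap.det (wordMap v u) = ∏ α, ((v.unitWeights.run u).wt α)⁻¹ := by
  rw [wordMap, LinearMap.det_toLpLin, Matrix.det_mul, RauzyVertex.det_lengthMatrix hA, one_mul,
    Matrix.det_diagonal]

theorem sum_wordMap (v : RauzyVertex A) (u : List (Fin 2)) (x : EuclideanSpace ℝ A) :
    ∑ α, wordMap v u x α = ∑ α, x α := by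
  have h := RauzyVertex.sum_wt_mul_lengthMatrix_mulVec v.unitWeights u
    fun β => ((v.unitWeights.run u).wt β)⁻¹ * x β
  simp_rw [wordMap_apply]
  have h1 (α) : v.unitWeights.wt α = 1 := rfl
  simp_rw [h1, one_mul] at h
  refine h.trans (Finset.sum_congr rfl fun α _ => ?_)
  rw [mul_inv_cancel_left₀ ((v.unitWeights.run u).wt_pos α).ne']

theorem mem_wordSimplex_nil {v : RauzyVertex A} {x : EuclideanSpace ℝ A} :
    x ∈ wordSimplex v [] ↔ (∀ α, 0 < x α) ∧ ∑ α, x α = 1 := by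
  constructor
  · rintro ⟨T, -, hT, hs, -⟩
    refine ⟨fun α => hT α ▸ T.len_pos α, ?_⟩
    rw [← hs]
    exact Finset.sum_congr rfl fun α _ => (hT α).symm
  · rintro ⟨hx, hs⟩
    exact ⟨⟨v, x, hx⟩, rfl, fun _ => rfl, hs, trivial⟩

/-- The final lengths range over all positive vectors; rescaling them by the weights turns the
condition of total initial length 1 into that of the standard simplex. -/
theorem wordSimplex_eq_image (hA : 1 < Fintype.card A) (v : RauzyVertex A) (u : List (Fin 2)) :
    wordSimplex v u = wordMap v u '' wordSimplex v [] := by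
  have hq := (v.unitWeights.run u).wt_pos
  ext x
  constructor
  · rintro ⟨T, rfl, hT, hs, hu⟩
    obtain ⟨y, hy, hTy⟩ := (T.follows_iff_exists hA u).1 hu
    have hmap : wordMap T.vertex u
        (WithLp.toLp 2 fun α => (T.vertex.unitWeights.run u).wt α * y α) = x := by
      ext α
      rw [wordMap_apply, ← hT α, hTy]
      congr 1
      ext β
      exact inv_mul_cancel_left₀ (hq β).ne' (y β)
    refine ⟨_, mem_wordSimplex_nil.2 ⟨fun α => mul_pos (hq α) (hy α), ?_⟩, hmap⟩
    rw [← sum_wordMap T.vertex u, hmap, ← hs]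
    exact Finset.sum_congr rfl fun α _ => (hT α).symm
  · rintro ⟨x, hx, rfl⟩
    obtain ⟨hx, hs⟩ := mem_wordSimplex_nil.1 hx
    have hpos : ∀ β, 0 < ((v.unitWeights.run u).wt β)⁻¹ * x β := fun β =>
      mul_pos (inv_pos.2 (hq β)) (hx β)
    refine ⟨⟨v, wordMap v u x, fun α => ?_⟩, rfl, fun _ => rfl, ?_, ?_⟩
    · rw [wordMap_apply]
      exact v.lengthMatrix_mulVec_pos u hpos α
    · exact (sum_wordMap v u x).trans hs
    · rw [IEM.follows_iff_exists hA]
      exact ⟨_, hpos, funext fun α => wordMap_apply v u x α⟩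

theorem measurableSet_wordSimplex (hA : 1 < Fintype.card A) (v : RauzyVertex A)
    (u : List (Fin 2)) : MeasurableSet (wordSimplex v u) := by
  have hnil : MeasurableSet (wordSimplex v []) := by
    have : wordSimplex v [] = {x | ∀ α, 0 < x α} ∩ {x | ∑ α, x α = 1} := by
      ext x
      exact mem_wordSimplex_nil
    rw [this]
    refine MeasurableSet.inter ?_ (isClosed_eq (by fun_prop) continuous_const).measurableSet
    rw [Set.ofPred_forall]
    exact MeasurableSet.iInter fun α =>
      (isOpen_lt continuous_const (by fun_prop)).measurableSet
  rw [wordSimplex_eq_image hA]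
  refine hnil.image_of_continuousOn_injOn
    (LinearMap.continuous_of_finiteDimensional _).continuousOn ?_
  have hdet : LinearMap.det (wordMap v u) ≠ 0 := by
    rw [det_wordMap hA]
    exact Finset.prod_ne_zero_iff.2 fun α _ => inv_ne_zero ((v.unitWeights.run u).wt_pos α).ne'
  exact (LinearMap.equivOfDetNeZero _ hdet).injective.injOn

theorem simplexVolume_wordSimplex (hA : 1 < Fintype.card A) (v : RauzyVertex A)
    (u : List (Fin 2)) :
    simplexVolume A (wordSimplex v u) =
      ENNReal.ofReal (∏ α, ((v.unitWeights.run u).wt α)⁻¹) * simplexVolume A (wordSimplex v []) := by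
  rw [wordSimplex_eq_image hA, simplexVolume_image_linearMap _ (sum_wordMap v u), det_wordMap hA,
    abs_of_nonneg]
  · exact Finset.prod_nonneg fun α _ => (inv_pos.2 ((v.unitWeights.run u).wt_pos α)).le
  · exact fun x hx => (mem_wordSimplex_nil.1 hx).2

theorem WeightedVertex.prod_inv_next (s : WeightedVertex A)
    (ε : Fin 2) : ∏ α, ((s.next ε).wt α)⁻¹ = s.prob ε * ∏ α, (s.wt α)⁻¹ := by
  set l := s.vertex.lastName (1 - ε) with hl
  rw [← Finset.mul_prod_erase _ _ (Finset.mem_univ l), ← Finset.mul_prod_erase _ _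
    (Finset.mem_univ l), hl, s.next_wt_loser, ← hl, prob, ← hl]
  have h : ∏ α ∈ Finset.univ.erase l, ((s.next ε).wt α)⁻¹ =
      ∏ α ∈ Finset.univ.erase l, (s.wt α)⁻¹ :=
    Finset.prod_congr rfl fun α hα => by rw [s.next_wt_of_ne ε (Finset.ne_of_mem_erase hα)]
  rw [h]
  have h1 := s.wt_pos l
  have h2 := s.wt_pos (s.vertex.lastName ε)
  field_simp
  ring

theorem simplexVolume_wordSimplex_append (hA : 1 < Fintype.card A) (v : RauzyVertex A)
    (u : List (Fin 2)) (ε : Fin 2) :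
    simplexVolume A (wordSimplex v (u ++ [ε])) =
      ENNReal.ofReal ((v.unitWeights.run u).prob ε) * simplexVolume A (wordSimplex v u) := by
  rw [simplexVolume_wordSimplex hA, simplexVolume_wordSimplex hA v u, WeightedVertex.run_append,
    WeightedVertex.run_cons, WeightedVertex.run_nil, WeightedVertex.prod_inv_next,
    ENNReal.ofReal_mul (WeightedVertex.prob_pos _ _).le, mul_assoc]

theorem wordSimplex_append_subset (v : RauzyVertex A) (u w : List (Fin 2)) :
    wordSimplex v (u ++ w) ⊆ wordSimplex v u := by
  rintro x ⟨T, h1, h2, h3, h4⟩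
  exact ⟨T, h1, h2, h3, h4.of_append⟩

theorem disjoint_wordSimplex_append (v : RauzyVertex A) (u : List (Fin 2)) :
    Disjoint (wordSimplex v (u ++ [0])) (wordSimplex v (u ++ [1])) := by
  rw [Set.disjoint_left]
  rintro x ⟨T, h1, h2, -, h4⟩ ⟨T', h1', h2', -, h4'⟩
  obtain rfl : T = T' := IEM.ext_of (h1.trans h1'.symm) fun α => (h2 α).trans (h2' α).symm
  exact zero_ne_one (h4.eq_of_append h4')

/-- The two one-arrow extensions of a word have disjoint simplices, with proportions of volume given
by `prob`; the sets are glued along the tree of the certificate. -/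
theorem Reach.exists_subset (hA : 1 < Fintype.card A) (v : RauzyVertex A)
    {G : List (Fin 2) → Prop} {s : WeightedVertex A} {p : ℝ} (h : Reach G s p)
    (u : List (Fin 2)) (hs : s = v.unitWeights.run u) :
    ∃ Δ' ⊆ wordSimplex v u, MeasurableSet Δ' ∧
      ENNReal.ofReal p * simplexVolume A (wordSimplex v u) ≤ simplexVolume A Δ' ∧
      ∀ x ∈ Δ', ∃ w, G w ∧ x ∈ wordSimplex v (u ++ w) := by
  induction h generalizing u with
  | zero hp => exact ⟨∅, Set.empty_subset _, .empty, by simp [ENNReal.ofReal_of_nonpos hp], by simp⟩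
  | attained hp hG =>
    refine ⟨_, subset_rfl, measurableSet_wordSimplex hA v u, ?_, fun x hx => ⟨[], hG, by simpa⟩⟩
    exact mul_le_of_le_one_left zero_le (by simpa using ENNReal.ofReal_le_ofReal hp)
  | @node G s p a _ hp ih =>
    choose Δ hsub hmeas hvol hmem using fun ε => ih ε (u ++ [ε]) (by
      rw [WeightedVertex.run_append, ← hs]; rfl)
    refine ⟨Δ 0 ∪ Δ 1, Set.union_subset ((hsub 0).trans (wordSimplex_append_subset v u _))
      ((hsub 1).trans (wordSimplex_append_subset v u _)), (hmeas 0).union (hmeas 1), ?_, ?_⟩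
    · rw [measure_union ((disjoint_wordSimplex_append v u).mono (hsub 0) (hsub 1)) (hmeas 1)]
      refine le_trans ?_ (add_le_add (hvol 0) (hvol 1))
      rw [simplexVolume_wordSimplex_append hA, simplexVolume_wordSimplex_append hA, ← hs,
        ← mul_assoc, ← mul_assoc, ← add_mul]
      gcongr
      refine (ENNReal.ofReal_le_ofReal hp).trans (ENNReal.ofReal_add_le.trans ?_)
      rw [ENNReal.ofReal_mul (s.prob_pos 0).le, ENNReal.ofReal_mul (s.prob_pos 1).le, mul_comm,
        mul_comm (ENNReal.ofReal (s.prob 1))]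
    · rintro x (hx | hx)
      all_goals
        obtain ⟨w, hw, hxw⟩ := hmem _ x hx
        exact ⟨_ :: w, hw, by simpa using hxw⟩

end WordSimplex


/-! ### From words to paths and segments -/

section Paths

variable {A : Type*} [Fintype A] [Nonempty A]

theorem RauzyVertex.getElem_names (v : RauzyVertex A) (u : List (Fin 2)) (i : ℕ)
    (h : i < u.length) :
    (v.names u)[i]'(by simpa using h) = (v.run (u.take i)).lastName u[i] := by
  induction u generalizing v i with
  | nil => simp at h
  | cons ε u ih =>
    cases i with
    | zero => rfl
    | succ i => exact ih (v.op ε) i (by simpa using h)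

theorem IEM.Follows.exists_mem_arrow {T : IEM A} {u : List (Fin 2)} (h : T.Follows u) {i : ℕ}
    {α : A} (hα : (T.vertex.names u)[i]? = some α) : ∃ a ∈ T.arrow (i + 1), a.name = α := by
  obtain ⟨hi, rfl⟩ := List.getElem?_eq_some_iff.1 hα
  rw [RauzyVertex.length_names] at hi
  refine ⟨_, (T.follows_iff u).1 h i hi, ?_⟩
  rw [T.vertex.getElem_names u i hi]
  rfl

theorem CoveredByBlocks.coveredBySegments {T : IEM A} {m l p : ℕ} {x : List A}
    (hx : CoveredByBlocks m l x)
    (hT : ∀ (i : ℕ) (α : A), x[i]? = some α → ∃ a ∈ T.arrow (p + i), a.name = α) :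
    T.CoveredBySegments l m p (p + x.length) := by
  induction l generalizing p x with
  | zero =>
    rw [show x = [] from hx]
    exact ⟨Fin.elim0, Fin.elim0, fun i => i.elim0, fun n h1 h2 => by simp at h2; omega⟩
  | succ l ih =>
    obtain ⟨b, r, rfl, hb, hr⟩ := hx
    obtain ⟨s, t, hst, hcov⟩ := ih (p := p + b.length) hr fun i α hα => by
      rw [add_assoc]
      exact hT _ α (by simpa [List.getElem?_append_right] using hα)
    have hbT (i : ℕ) (hi : i < b.length) : ∃ a ∈ T.arrow (p + i), a.name = b[i] :=
      hT i _ (by rw [List.getElem?_append_left hi, List.getElem?_eq_getElem hi])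
    refine ⟨Fin.cons p s, Fin.cons (p + b.length) t, fun i => ?_, fun n h1 h2 => ?_⟩
    · refine Fin.cases ?_ (fun i => by simpa using hst i) i
      simp only [Fin.cons_zero]
      refine ⟨fun n h1 h2 => ?_, ?_⟩
      · obtain ⟨a, ha, -⟩ := hbT (n - p) (by omega)
        rw [Nat.add_sub_cancel' h1] at ha
        exact Option.isSome_iff_exists.2 ⟨a, ha⟩
      · refine le_trans (le_trans (Set.ncard_le_ncard ?_ b.toFinset.finite_toSet)
          (Set.ncard_coe_finset _).le) hb
        rintro α ⟨n, h1, h2, a, ha, rfl⟩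
        obtain ⟨a', ha', h⟩ := hbT (n - p) (by omega)
        rw [Nat.add_sub_cancel' h1] at ha'
        rw [Option.mem_unique ha ha', h]
        simp
    · rcases lt_or_ge n (p + b.length) with h | h
      · exact ⟨0, by simpa using h1, by simpa using h⟩
      · obtain ⟨i, hi⟩ := hcov n h (by rw [List.length_append] at h2; omega)
        exact ⟨i.succ, by simpa using hi⟩

/-- The word of the types of the arrows of a path. -/
def RauzyPath.word {v : RauzyVertex A} {N : ℕ} (γ : RauzyPath v N) : List (Fin 2) :=
  List.ofFn fun i => (γ.arrow i).type

@[simp] theorem RauzyPath.length_word {v : RauzyVertex A} {N : ℕ} (γ : RauzyPath v N) :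
    γ.word.length = N := List.length_ofFn

theorem RauzyPath.getElem_word {v : RauzyVertex A} {N : ℕ} (γ : RauzyPath v N) (i : ℕ)
    (h : i < N) : γ.word[i]'(by simpa using h) = (γ.arrow ⟨i, h⟩).type := by
  simp [word]

theorem RauzyPath.source_arrow {v : RauzyVertex A} {N : ℕ} (γ : RauzyPath v N) (i : ℕ)
    (h : i < N) : (γ.arrow ⟨i, h⟩).source = v.run (γ.word.take i) := by
  induction i with
  | zero => exact γ.start h
  | succ i ih =>
    rw [γ.chain i h, RauzyArrow.target, ih (by omega), ← γ.getElem_word i (by omega),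
      List.take_succ_eq_append_getElem (by simp; omega), RauzyVertex.run_append]
    rfl

theorem RauzyPath.arrow_eq {v : RauzyVertex A} {N : ℕ} (γ : RauzyPath v N) (i : ℕ) (h : i < N) :
    γ.arrow ⟨i, h⟩ = ⟨v.run (γ.word.take i), γ.word[i]'(by simpa using h)⟩ := by
  rw [← γ.source_arrow i h, γ.getElem_word i h]

theorem RauzyPath.simplex_eq {v : RauzyVertex A} {N : ℕ} (γ : RauzyPath v N) :
    γ.simplex = wordSimplex v γ.word := by
  ext x
  refine exists_congr fun T => and_congr_right fun hv => and_congr_right fun _ =>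
    and_congr_right fun _ => ?_
  rw [T.follows_iff, hv]
  constructor
  · intro h i hi
    rw [h ⟨i, by simpa using hi⟩, γ.arrow_eq]
  · rintro h ⟨i, hi⟩
    rw [h i (by simpa using hi), γ.arrow_eq]

theorem RauzyPath.names_eq {v : RauzyVertex A} {N : ℕ} (γ : RauzyPath v N) :
    γ.names = ((v.names γ.word).toFinset : Set A) := by
  have h (i : ℕ) (hi : i < N) :
      (v.names γ.word)[i]'(by simpa using hi) = (γ.arrow ⟨i, hi⟩).name := by
    rw [v.getElem_names γ.word i (by simpa using hi), γ.arrow_eq]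
    rfl
  ext α
  rw [names, Set.mem_range, Finset.mem_coe, List.mem_toFinset, List.mem_iff_getElem]
  constructor
  · rintro ⟨⟨i, hi⟩, rfl⟩
    exact ⟨i, by simpa using hi, h i hi⟩
  · rintro ⟨i, hi, rfl⟩
    rw [RauzyVertex.length_names, γ.length_word] at hi
    exact ⟨⟨i, hi⟩, (h i hi).symm⟩

end Paths

/-! ### Conclusion -/

/-- The heaviest name of `S` has at least the proportion `1 / d` of the total weight of `S`, which
bounds all weights, so `largeExitBound` applies with `G` reduced to this name and blocks of `card S
- 1` names. The constants are made independent of `card S` by a sum and a minimum. -/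
theorem exists_uniform_exit (d : ℕ) : ∃ (l : ℕ) (p : ℝ), 0 < p ∧
    ∀ (A : Type u) [Fintype A] [Nonempty A], Fintype.card A = d →
      ∀ S : Finset A, 1 < S.card → S ≠ Finset.univ → ∀ s : WeightedVertex A,
        (∀ α, s.wt α ≤ ∑ x ∈ S, s.wt x) →
          ∃ M, Reach (Exits s S (S.card - 1) l M) s p := by
  have h (j : ℕ) : ∃ (p : ℝ) (l : ℕ), 0 < p ∧ (1 < j → j ≤ d →
      ∀ (A : Type u) [Fintype A] [Nonempty A], Fintype.card A = d →
        ∀ S : Finset A, S.card = j → S ≠ Finset.univ → ∀ s : WeightedVertex A,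
          (∀ α, s.wt α ≤ ∑ x ∈ S, s.wt x) → ∃ M, Reach (Exits s S (j - 1) l M) s p) := by
    by_cases hj : 1 < j ∧ j ≤ d
    · have hd : (0 : ℝ) < d := by exact_mod_cast (by omega : 0 < d)
      obtain ⟨p, K, l, hp, -, H⟩ := largeExitBound.{u} (m := j - 1) (by omega) (by omega)
        (exitBound d j hj.2) (j + 1) (1 / d) (by positivity)
      refine ⟨p, l, hp, fun _ _ A _ _ hA S hS hSu s hs => ⟨K * ∑ x ∈ S, s.wt x, ?_⟩⟩
      obtain ⟨g, hg, hmax⟩ := Finset.exists_max_image S s.wt (Finset.card_pos.1 (by omega))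
      refine H A hA S {g} (by simpa using hg) (Finset.singleton_nonempty g) hS ?_ hSu s _ hs ?_
      · have := Finset.card_le_card (Finset.sdiff_subset (s := S) (t := {g}))
        omega
      · intro x hx
        rw [Finset.mem_singleton.1 hx, one_div, inv_mul_le_iff₀ hd]
        refine (Finset.sum_le_card_nsmul S s.wt _ hmax).trans ?_
        rw [nsmul_eq_mul]
        have := (s.wt_pos g).le
        gcongr
        omega
    · exact ⟨1, 0, one_pos, fun h1 h2 => absurd ⟨h1, h2⟩ hj⟩
  choose p l hp h using h
  refine ⟨∑ j ∈ Finset.range (d + 1), l j, (Finset.range (d + 1)).inf' Finset.nonempty_range_add_one p, ?_, ?_⟩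
  · exact (Finset.lt_inf'_iff _).2 fun j _ => hp j
  · intro A _ _ hA S hS hSu s hs
    have hSd : S.card ≤ d := hA ▸ Finset.card_le_univ S
    have hmem : S.card ∈ Finset.range (d + 1) := Finset.mem_range.2 (by omega)
    obtain ⟨M, hM⟩ := h S.card hS hSd A hA S rfl hSu s hs
    refine ⟨M, (hM.weaken (Finset.inf'_le _ hmem)).mono fun w hw => hw.mono ?_ le_rfl⟩
    exact Finset.single_le_sum (f := l) (fun _ _ => Nat.zero_le _) hmem

theorem IEM.Follows.coveredBySegments {A : Type*} [Fintype A] [Nonempty A] {T : IEM A}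
    {u w : List (Fin 2)} {m l : ℕ} {M : ℝ} {S : Finset A} (hu : u ≠ []) (hm : 1 ≤ m)
    (hT : T.Follows (u ++ w)) {s : WeightedVertex A} (hs : s.vertex = T.vertex.run u)
    (hw : Exits s S m l M w) :
    ∃ k, u.length < k ∧ (∃ a ∈ T.arrow k, a.name ∉ S) ∧
      T.CoveredBySegments (l + 1) m u.length k := by
  obtain ⟨y, ε, rfl, -, hcov, hout, -⟩ := hw
  rw [hs] at hcov hout
  obtain ⟨u', δ, rfl⟩ := List.eq_nil_or_concat' u |>.resolve_left hu
  refine ⟨(u' ++ [δ]).length + y.length + 1, by omega, ?_, ?_⟩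
  · obtain ⟨a, ha, h⟩ := hT.exists_mem_arrow (i := (u' ++ [δ]).length + y.length)
      (α := ((T.vertex.run (u' ++ [δ])).run y).lastName ε) (by
        rw [RauzyVertex.names_append, RauzyVertex.names_append (T.vertex.run _),
          List.getElem?_append_right (by simp), List.getElem?_append_right (by simp)]
        simp)
    exact ⟨a, ha, h ▸ hout⟩
  -- The range to be covered starts at the last arrow of the given path; this arrow takes one
  -- additional block, hence `l + 1`.
  · set x := (T.vertex.run u').lastName δ :: (T.vertex.run (u' ++ [δ])).names y with hx
    have hxc : CoveredByBlocks m (l + 1) x := ⟨[_], _, rfl, by simpa using hm, hcov⟩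
    have hlen : (u' ++ [δ]).length + y.length + 1 = (u' ++ [δ]).length + x.length := by
      simp [hx, add_assoc]
    rw [hlen]
    refine hxc.coveredBySegments fun i α hα => ?_
    have hnames : T.vertex.names (u' ++ [δ] ++ (y ++ [ε])) = T.vertex.names u' ++
        (x ++ ((T.vertex.run (u' ++ [δ])).run y).names [ε]) := by
      simp [hx, RauzyVertex.names_append, RauzyVertex.run_append]
    have := hT.exists_mem_arrow (i := u'.length + i) (α := α) (by
      rw [hnames, List.getElem?_append_right (by simp),
        List.getElem?_append_left (by simpa using (List.getElem?_eq_some_iff.1 hα).1)]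
      simpa using hα)
    rwa [List.length_append, List.length_singleton, add_right_comm]

end

theorem mainTheorem6 (d : ℕ) :
    ∃ (l : ℕ) (η : ℝ), 0 < η ∧
      ∀ (A : Type*) [Fintype A] [Nonempty A], Fintype.card A = d →
        ∀ (v : RauzyVertex A) (N : ℕ) (γ : RauzyPath v N),
          γ.names ≠ Set.univ → 1 < γ.names.ncard →
          ∃ Δ' : Set (EuclideanSpace ℝ A), Δ' ⊆ γ.simplex ∧ MeasurableSet Δ' ∧
            ENNReal.ofReal η * simplexVolume A γ.simplex ≤ simplexVolume A Δ' ∧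
            ∀ T : IEM A, T.vertex = v → WithLp.toLp 2 T.len ∈ Δ' →
              ∃ M : ℕ, N < M ∧ (∃ a ∈ T.arrow M, a.name ∉ γ.names) ∧
                T.CoveredBySegments l (γ.names.ncard - 1) N M := by
  classical
  obtain ⟨l, p, hp, H⟩ := exists_uniform_exit d
  refine ⟨l + 1, p, hp, fun A _ _ hA v N γ hne hcard => ?_⟩
  rw [γ.names_eq] at hne hcard ⊢
  rw [Set.ncard_coe_finset] at hcard ⊢
  set S := (v.names γ.word).toFinset with hS
  have hSu : S ≠ Finset.univ := fun h => hne (by rw [h, Finset.coe_univ])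
  have hA1 : 1 < Fintype.card A := hcard.trans_le (Finset.card_le_univ S)
  obtain ⟨M, hM⟩ := H A hA S hcard hSu (v.unitWeights.run γ.word)
    (WeightedVertex.wt_run_le_sum hA1 (fun _ => rfl) γ.word hS.symm hcard)
  obtain ⟨Δ', hsub, hmeas, hvol, hmem⟩ := hM.exists_subset hA1 v γ.word rfl
  rw [γ.simplex_eq]
  refine ⟨Δ', hsub, hmeas, hvol, fun T hT hTΔ => ?_⟩
  obtain ⟨w, hw, T', hT', hlen, -, hfol⟩ := hmem _ hTΔ
  obtain rfl : T' = T := IEM.ext_of (hT'.trans hT.symm) hlen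
  have hne : γ.word ≠ [] := by
    intro h
    rw [hS, h] at hcard
    simp at hcard
  have := hfol.coveredBySegments hne (by omega) (by rw [WeightedVertex.run_vertex, hT]; rfl) hw
  simpa using this
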